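/- Let $d \in \mathbb{N}$, $n \ge 1$ and $\delta \in (0,1)$. Let $P_X$ be a probability distribution on $\mathbb{R}^d$ whose support is not contained in any hyperplane $\{x : \langle w, x\rangle = 0\}$, $w \neq 0$, and let $\sigma^2 \in (0,\infty)$. Let $e : \mathbb{R} \to \mathbb{R}$ be strictly convex, differentiable and symmetric, i.e. $e(-t) = e(t)$ for all $t$. For a distribution $P$ of $(X,Y)$ on $\mathbb{R}^d \times \mathbb{R}$ and $w \in \mathbb{R}^d$ let $E(w) := \mathbb{E}[e(\langle w, X\rangle - Y)]$ and $\mathcal{E}(w) := E(w) - \inf_{v \in \mathbb{R}^d} E(v)$. For a $[0,\infty]$-valued random variable $L$ let $Q_L(p) := \inf\{t \in [0,\infty) : \mathbb{P}(L \le t) \ge p\}$ (with $\inf \emptyset = \infty$). A procedure is a measurable map $\hat w : (\mathbb{R}^d \times \mathbb{R})^n \to \mathbb{R}^d$; its quantile risk under $P$ is $$R_{n,\delta}(P, \hat w) := Q_{\mathcal{E}(\hat w((X_i,Y_i)_{i=1}^n))}(1-\delta), \qquad (X_i,Y_i)_{i=1}^n \sim P^{n}.$$ For a class $\mathcal{P}$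 of distributions its worst-case risk is $R_{n,\delta}(\mathcal{P}, \hat w) := \sup_{P \in \mathcal{P}} R_{n,\delta}(P, \hat w)$, the minimax risk is $R^*_{n,\delta}(\mathcal{P}) := \inf_{\hat w} R_{n,\delta}(\mathcal{P}, \hat w)$, and $\hat w$ is minimax if $R_{n,\delta}(\mathcal{P}, \hat w) = R^*_{n,\delta}(\mathcal{P})$. Let $\mathcal{P}_{\mathrm{Gauss}}(P_X, \sigma^2)$ be the class of the laws of $(X, \langle w^*, X\rangle + \eta)$ with $w^* \in \mathbb{R}^d$ and $(X, \eta) \sim P_X \times \mathcal{N}(0, \sigma^2)$. Define, for $(X, \eta) \sim P_X \times \mathcal{N}(0,\sigma^2)$, $$\widetilde{E}(\Delta) := \mathbb{E}[e(\langle \Delta, X\rangle + \eta)], \qquad \widetilde{\mathcal{E}}(\Delta) := \widetilde{E}(\Delta) - \widetilde{E}(0),$$ and assume that $\widetilde{E}$ is finite everywhere and differentiable at $0$ with $\nabla \widetilde{E}(0) = \mathbb{E}[e'(\eta) X]$. Then $$R^*_{n,\delta}(\mathcal{P}_{\mathrm{Gauss}}(P_X, \sigma^2)) = Q_{\widetilde{\mathcal{E}}(Z)}(1-\delta),$$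 where $Z$ is jointly distributed with $(X_i)_{i=1}^n \sim P_X^n$ such that $Z \mid (X_i)_{i=1}^n \sim \mathcal{N}(0, \frac{\sigma^2}{n} \widehat{\Sigma}_n^{-1})$ on the event that the sample covariance matrix $\widehat{\Sigma}_n := n^{-1} \sum_{i=1}^n X_i X_i^T$ is invertible, and $\widetilde{\mathcal{E}}(Z) := \infty$ otherwise. Moreover, every procedure $\hat w$ with $$\hat w((X_i,Y_i)_{i=1}^n) \in \operatorname*{argmin}_{w \in \mathbb{R}^d} \frac{1}{n} \sum_{i=1}^n (\langle w, X_i\rangle - Y_i)^2$$ for all data $(X_i, Y_i)_{i=1}^n$ is minimax over $\mathcal{P}_{\mathrm{Gauss}}(P_X, \sigma^2)$. -/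

import Mathlib

open MeasureTheory ProbabilityTheory Set
open scoped NNReal ENNReal InnerProductSpace

noncomputable section

namespace LinReg

/-- The `p`-quantile `inf {t ≥ 0 | ℙ(L ≤ t) ≥ p}` of a random variable `L` with values in `[0, ∞]`;
it is `∞` when no finite `t` qualifies. -/
def quantile {Ω : Type*} [MeasurableSpace Ω] (μ : Measure Ω) (L : Ω → ℝ≥0∞) (p : ℝ) : ℝ≥0∞ :=
  ⨅ (t : ℝ≥0) (_ : ENNReal.ofReal p ≤ μ {ω | L ω ≤ t}), (t : ℝ≥0∞)

variable {d n : ℕ}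

/-- Expected error `E(w) = 𝔼[e(⟪w, X⟫ - Y)]` of the linear predictor `w` under `(X, Y) ∼ P`. -/
def expectedError (e : ℝ → ℝ) (P : Measure (EuclideanSpace ℝ (Fin d) × ℝ))
    (w : EuclideanSpace ℝ (Fin d)) : ℝ :=
  ∫ q, e (⟪w, q.1⟫_ℝ - q.2) ∂P

/-- Excess expected error `ℰ(w) = E(w) - inf_v E(v)`. -/
def excessError (e : ℝ → ℝ) (P : Measure (EuclideanSpace ℝ (Fin d) × ℝ))
    (w : EuclideanSpace ℝ (Fin d)) : ℝ :=
  expectedError e P w - ⨅ v, expectedError e P v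

/-- Quantile risk of the procedure `what` fed with `n` i.i.d. samples of law `P`: the
`(1 - δ)`-quantile of its excess expected error (which is nonnegative, so that `ENNReal.ofReal`
only changes its type). -/
def quantileRisk (e : ℝ → ℝ) (n : ℕ) (δ : ℝ) (P : Measure (EuclideanSpace ℝ (Fin d) × ℝ))
    (what : (Fin n → EuclideanSpace ℝ (Fin d) × ℝ) → EuclideanSpace ℝ (Fin d)) : ℝ≥0∞ :=
  quantile (Measure.pi fun _ : Fin n => P)
    (fun D => ENNReal.ofReal (excessError e P (what D))) (1 - δ)

/-- Worst-case quantile risk of a procedure over a class of distributions. -/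
def worstCaseRisk (e : ℝ → ℝ) (n : ℕ) (δ : ℝ) (Ps : Set (Measure (EuclideanSpace ℝ (Fin d) × ℝ)))
    (what : (Fin n → EuclideanSpace ℝ (Fin d) × ℝ) → EuclideanSpace ℝ (Fin d)) : ℝ≥0∞ :=
  ⨆ P ∈ Ps, quantileRisk e n δ P what

/-- Minimax quantile risk: the infimum of the worst-case risk over all (measurable) procedures. -/
def minimaxQuantileRisk (e : ℝ → ℝ) (n : ℕ) (δ : ℝ)
    (Ps : Set (Measure (EuclideanSpace ℝ (Fin d) × ℝ))) : ℝ≥0∞ :=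
  ⨅ (what : (Fin n → EuclideanSpace ℝ (Fin d) × ℝ) → EuclideanSpace ℝ (Fin d))
    (_ : Measurable what), worstCaseRisk e n δ Ps what

/-- A (measurable) procedure is minimax if its worst-case risk is the minimax risk. -/
def IsMinimax (e : ℝ → ℝ) (n : ℕ) (δ : ℝ) (Ps : Set (Measure (EuclideanSpace ℝ (Fin d) × ℝ)))
    (what : (Fin n → EuclideanSpace ℝ (Fin d) × ℝ) → EuclideanSpace ℝ (Fin d)) : Prop :=
  Measurable what ∧ worstCaseRisk e n δ Ps what = minimaxQuantileRisk e n δ Ps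

/-- A procedure that always returns a minimizer of the empirical mean squared error. -/
def IsLeastSquares
    (what : (Fin n → EuclideanSpace ℝ (Fin d) × ℝ) → EuclideanSpace ℝ (Fin d)) : Prop :=
  ∀ D : Fin n → EuclideanSpace ℝ (Fin d) × ℝ,
    IsMinOn (fun w : EuclideanSpace ℝ (Fin d) =>
      (1 / (n : ℝ)) * ∑ i, (⟪w, (D i).1⟫_ℝ - (D i).2) ^ 2) univ (what D)

/-- The class of laws of `(X, ⟪w, X⟫ + η)`, `w ∈ ℝ^d`, where `(X, η) ∼ P_X × N(0, σ²)`.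
Here and below `σsq` is the variance `σ²`. -/
def gaussClass (PX : Measure (EuclideanSpace ℝ (Fin d))) (σsq : ℝ≥0) :
    Set (Measure (EuclideanSpace ℝ (Fin d) × ℝ)) :=
  {P | ∃ w : EuclideanSpace ℝ (Fin d),
    P = (PX.prod (gaussianReal 0 σsq)).map (fun q => (q.1, ⟪w, q.1⟫_ℝ + q.2))}

/-- `Ẽ(Δ) = 𝔼[e(⟪Δ, X⟫ + η)]` for `(X, η) ∼ P_X × N(0, σ²)`. -/
def tildeE (e : ℝ → ℝ) (PX : Measure (EuclideanSpace ℝ (Fin d))) (σsq : ℝ≥0)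
    (Δ : EuclideanSpace ℝ (Fin d)) : ℝ :=
  ∫ q, e (⟪Δ, q.1⟫_ℝ + q.2) ∂(PX.prod (gaussianReal 0 σsq))

/-- `ℰ̃(Δ) = Ẽ(Δ) - Ẽ(0)`. -/
def tildeExcess (e : ℝ → ℝ) (PX : Measure (EuclideanSpace ℝ (Fin d))) (σsq : ℝ≥0)
    (Δ : EuclideanSpace ℝ (Fin d)) : ℝ :=
  tildeE e PX σsq Δ - tildeE e PX σsq 0

/-- Sample covariance matrix `n⁻¹ ∑ᵢ xᵢ xᵢᵀ`. -/
def sampleCov (x : Fin n → EuclideanSpace ℝ (Fin d)) : Matrix (Fin d) (Fin d) ℝ :=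
  (n : ℝ)⁻¹ • ∑ i, Matrix.vecMulVec (x i).ofLp (x i).ofLp

open Classical in
/-- The conditional law of `Z` given the inputs `x`: it is `N(0, (σ²/n) Σ̂ₙ⁻¹)` if `Σ̂ₙ` is
invertible (the other value is immaterial). -/
def condLaw (σsq : ℝ≥0) (x : Fin n → EuclideanSpace ℝ (Fin d)) :
    Measure (EuclideanSpace ℝ (Fin d)) :=
  if IsUnit (sampleCov x) then
    multivariateGaussian 0 (((σsq : ℝ) / n) • (sampleCov x)⁻¹)
  else Measure.dirac 0

lemma sampleCov_apply (x : Fin n → EuclideanSpace ℝ (Fin d)) (j k : Fin d) :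
    sampleCov x j k = (n : ℝ)⁻¹ * ∑ i, x i j * x i k := by
  simp [sampleCov, Matrix.sum_apply, Matrix.vecMulVec_apply]

lemma posSemidef_sampleCov (x : Fin n → EuclideanSpace ℝ (Fin d)) : (sampleCov x).PosSemidef := by
  refine Matrix.PosSemidef.smul (Matrix.posSemidef_sum _ fun i _ => ?_) (by positivity)
  simpa using Matrix.posSemidef_vecMulVec_self_star (x i).ofLp

/-- The Gaussian law `N(0, c Σ̂ₙ⁻¹)` as the image of a standard Gaussian under a linear map that
depends measurably on the inputs; only used for the measurability of `condLaw`. -/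
lemma multivariateGaussian_eq_map (c : ℝ) (hc : 0 ≤ c) (x : Fin n → EuclideanSpace ℝ (Fin d))
    (hx : IsUnit (sampleCov x)) :
    multivariateGaussian 0 (c • (sampleCov x)⁻¹) =
      (stdGaussian (EuclideanSpace ℝ (Fin n))).map (fun g => WithLp.toLp 2
        (((Real.sqrt (c * (n : ℝ)⁻¹)) • ((sampleCov x)⁻¹ * Matrix.of fun j i => x i j)).mulVec
          g.ofLp)) := by
  have hcomm : ∀ (A : Matrix (Fin d) (Fin n) ℝ), Continuous
      (fun g : EuclideanSpace ℝ (Fin n) => WithLp.toLp 2 (A.mulVec g.ofLp)) := by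
    intro A; fun_prop
  set A : Matrix (Fin d) (Fin n) ℝ :=
    (Real.sqrt (c * (n : ℝ)⁻¹)) • ((sampleCov x)⁻¹ * Matrix.of fun j i => x i j) with hA
  have hm := (hcomm A).measurable
  have : IsProbabilityMeasure ((stdGaussian (EuclideanSpace ℝ (Fin n))).map
    (fun g => WithLp.toLp 2 (A.mulVec g.ofLp))) := Measure.isProbabilityMeasure_map hm.aemeasurable
  have hps : (c • (sampleCov x)⁻¹).PosSemidef := (posSemidef_sampleCov x).inv.smul hc
  have hsym : (sampleCov x)⁻¹.transpose = (sampleCov x)⁻¹ := by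
    have := (posSemidef_sampleCov x).inv.isHermitian
    simpa [Matrix.IsHermitian, Matrix.conjTranspose_eq_transpose_of_trivial] using this
  have hAA : A * A.transpose = c • (sampleCov x)⁻¹ := by
    have hB : (n : ℝ)⁻¹ • ((Matrix.of fun j i => x i j : Matrix (Fin d) (Fin n) ℝ) *
        (Matrix.of fun j i => x i j : Matrix (Fin d) (Fin n) ℝ).transpose) = sampleCov x := by
      ext j k
      simp [sampleCov_apply, Matrix.mul_apply]
    have hB' : ∀ M N : Matrix (Fin d) (Fin d) ℝ, (n : ℝ)⁻¹ • (M * (N * M)) =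
        M * (((n : ℝ)⁻¹ • N) * M) := fun M N => by rw [Matrix.smul_mul, Matrix.mul_smul]
    have hdet := (Matrix.isUnit_iff_isUnit_det _).1 hx
    rw [hA, Matrix.transpose_smul, Matrix.transpose_mul, hsym, Matrix.smul_mul, Matrix.mul_smul,
      smul_smul, Real.mul_self_sqrt (by positivity), mul_smul, Matrix.mul_assoc,
      ← Matrix.mul_assoc (Matrix.of fun j i => x i j), hB', hB, Matrix.mul_nonsing_inv _ hdet, Matrix.mul_one]
  refine Measure.ext_of_charFun ?_
  funext t
  rw [charFun_multivariateGaussian hps, charFun_apply,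
    integral_map hm.aemeasurable (by fun_prop)]
  have hin : ∀ g : EuclideanSpace ℝ (Fin n), ⟪WithLp.toLp 2 (A.mulVec g.ofLp), t⟫_ℝ =
      ⟪g, WithLp.toLp 2 (A.transpose.mulVec t.ofLp)⟫_ℝ := by
    intro g
    simp only [EuclideanSpace.inner_eq_star_dotProduct, star_trivial]
    rw [Matrix.dotProduct_mulVec, Matrix.mulVec_transpose]
  simp only [hin]
  rw [← charFun_apply, charFun_stdGaussian]
  have hnorm : ‖(WithLp.toLp 2 (A.transpose.mulVec t.ofLp) : EuclideanSpace ℝ (Fin n))‖ ^ 2 =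
      t.ofLp ⬝ᵥ (c • (sampleCov x)⁻¹).mulVec t.ofLp := by
    rw [← real_inner_self_eq_norm_sq, EuclideanSpace.inner_eq_star_dotProduct, ← hAA,
      star_trivial, ← Matrix.mulVec_mulVec, Matrix.dotProduct_mulVec t.ofLp A,
      Matrix.mulVec_transpose]
  rw [← hnorm]
  congr 1
  simp
  ring

lemma measurable_condLaw (σsq : ℝ≥0) :
    Measurable (condLaw σsq : (Fin n → EuclideanSpace ℝ (Fin d)) →
      Measure (EuclideanSpace ℝ (Fin d))) := by
  classical
  have hdet : Measurable fun x : Fin n → EuclideanSpace ℝ (Fin d) => (sampleCov x).det := by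
    simp only [Matrix.det_apply, sampleCov_apply]
    fun_prop
  have hset : MeasurableSet {x : Fin n → EuclideanSpace ℝ (Fin d) | IsUnit (sampleCov x)} := by
    simp only [Matrix.isUnit_iff_isUnit_det, isUnit_iff_ne_zero]
    exact (hdet (measurableSet_singleton 0)).compl
  have hinv : ∀ j k, Measurable fun x : Fin n → EuclideanSpace ℝ (Fin d) =>
      (sampleCov x)⁻¹ j k := by
    intro j k
    simp only [Matrix.inv_def, Ring.inverse_eq_inv', Matrix.smul_apply, Matrix.adjugate_apply,
      Matrix.det_apply, Matrix.updateRow_apply, smul_eq_mul, sampleCov_apply]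
    refine Measurable.mul (by fun_prop) (Finset.measurable_sum _ fun σ _ =>
      Measurable.const_smul (Finset.measurable_prod _ fun i _ => ?_) _)
    split_ifs <;> fun_prop
  set c : ℝ := (σsq : ℝ) / n
  have hjoint : Measurable fun q : (Fin n → EuclideanSpace ℝ (Fin d)) × EuclideanSpace ℝ (Fin n) =>
      (WithLp.toLp 2 (((Real.sqrt (c * (n : ℝ)⁻¹)) • ((sampleCov q.1)⁻¹ *
        Matrix.of fun j i => q.1 i j)).mulVec q.2.ofLp) : EuclideanSpace ℝ (Fin d)) := by
    refine (WithLp.measurable_toLp 2 _).comp (measurable_pi_lambda _ fun j => ?_)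
    simp only [Matrix.mulVec, dotProduct, Matrix.smul_apply, Matrix.mul_apply, Matrix.of_apply,
      smul_eq_mul]
    refine Finset.measurable_sum _ fun i _ => Measurable.mul (Measurable.const_mul
      (Finset.measurable_sum _ fun k _ => Measurable.mul ((hinv j k).comp measurable_fst) ?_) _) ?_
    · fun_prop
    · fun_prop
  have hker : Measurable fun x : Fin n → EuclideanSpace ℝ (Fin d) =>
      (stdGaussian (EuclideanSpace ℝ (Fin n))).map (fun g => (WithLp.toLp 2
        (((Real.sqrt (c * (n : ℝ)⁻¹)) • ((sampleCov x)⁻¹ * Matrix.of fun j i => x i j)).mulVec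
          g.ofLp) : EuclideanSpace ℝ (Fin d))) := by
    refine Measure.measurable_of_measurable_coe _ fun s hs => ?_
    have h1 := measurable_measure_prodMk_left (ν := stdGaussian (EuclideanSpace ℝ (Fin n)))
      (hjoint hs)
    convert h1 using 2 with x
    exact Measure.map_apply (hjoint.comp measurable_prodMk_left) hs
  have heq : (condLaw σsq : (Fin n → EuclideanSpace ℝ (Fin d)) → _) =
      fun x => if IsUnit (sampleCov x) then
        (stdGaussian (EuclideanSpace ℝ (Fin n))).map (fun g => (WithLp.toLp 2
        (((Real.sqrt (c * (n : ℝ)⁻¹)) • ((sampleCov x)⁻¹ * Matrix.of fun j i => x i j)).mulVec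
          g.ofLp) : EuclideanSpace ℝ (Fin d))) else Measure.dirac 0 := by
    funext x
    unfold condLaw
    split_ifs with h
    · exact multivariateGaussian_eq_map c (by positivity) x h
    · rfl
  rw [heq]
  exact Measurable.ite hset hker measurable_const

/-- `condLaw` as a Markov kernel. -/
def condKernel (n : ℕ) (σsq : ℝ≥0) :
    Kernel (Fin n → EuclideanSpace ℝ (Fin d)) (EuclideanSpace ℝ (Fin d)) :=
  ⟨condLaw σsq, measurable_condLaw σsq⟩

instance (n : ℕ) (σsq : ℝ≥0) : IsMarkovKernel (condKernel (d := d) n σsq) := by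
  refine ⟨fun x => ?_⟩
  change IsProbabilityMeasure (condLaw σsq x)
  unfold condLaw
  split_ifs <;> infer_instance

/-- The joint law of `((X₁, …, Xₙ), Z)`, where the `Xᵢ` are i.i.d. of law `P_X` and `Z` has the
conditional law `condLaw` given the `Xᵢ`. -/
def jointLaw (n : ℕ) (PX : Measure (EuclideanSpace ℝ (Fin d))) (σsq : ℝ≥0) :
    Measure ((Fin n → EuclideanSpace ℝ (Fin d)) × EuclideanSpace ℝ (Fin d)) :=
  (Measure.pi fun _ : Fin n => PX) ⊗ₘ condKernel n σsq

open Classical in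
/-- The random variable `ℰ̃(Z)` on the space of pairs `((x₁, …, xₙ), z)`, set to `∞` when the sample
covariance matrix is singular. (The excess `ℰ̃` is nonnegative, so that `ENNReal.ofReal` only
changes its type.) -/
def limitLoss (n : ℕ) (e : ℝ → ℝ) (PX : Measure (EuclideanSpace ℝ (Fin d))) (σsq : ℝ≥0)
    (q : (Fin n → EuclideanSpace ℝ (Fin d)) × EuclideanSpace ℝ (Fin d)) : ℝ≥0∞ :=
  if IsUnit (sampleCov q.1) then ENNReal.ofReal (tildeExcess e PX σsq q.2) else ∞

end LinReg

end

open LinReg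

/-! In the Gaussian model the excess error of a predictor `v` is `tildeExcess` at `v - w`, a convex
symmetric function of the deviation from the true parameter `w`. Its sublevel sets `K` are compact.
The theorem therefore asks how large the probability of `what - w ∈ K`, in the worst case over `w`,
can be made.

Lower bound on the risk. The worst case over `w` is at least as bad as the average over a prior
`N(0, (σ/s)² I)`. Under this prior, for fixed inputs, the parameter is the ridge estimate plus a
centred Gaussian deviation independent of the observations (`indepFun_observation_ridgeError`). An
arbitrary estimator only translates this deviation by a function of the observations, and Anderson's
inequality says that translation cannot increase the mass of a symmetric convex `K`
(`measure_estimator_le`). Now let `s → 0`. If the sample covariance is invertible, the ridge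
deviation tends to minus the least squares error, whose law is `condLaw`. If it is singular, the
deviation has a component of size `1/s` along the kernel and almost surely leaves the compact set
`K`, which is why the limiting loss is `∞` there (`measure_limsup_ridgeError_le`). A reverse Fatou
argument gives `le_jointLaw_of_forall_le`.

Upper bound. On invertible designs the least squares error does not depend on `w` and has law
`condLaw`, so least squares is at least as good as the limiting loss, at every level and for every
`w`. Comparing distribution functions level by level yields the statement for quantiles.

Anderson's inequality comes from a midpoint Prékopa–Leindler inequality, which starts from
Brunn–Minkowski on the line, absorbs the log-concave Gaussian density, and passes to products and
linear images. -/

namespace LinReg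

/-! ### Prékopa–Leindler and Anderson inequalities for Gaussian measures -/

/-- One-dimensional Brunn–Minkowski inequality for midpoints. -/
theorem volume_add_volume_le_of_midpoint {A B C : Set ℝ} (hA : MeasurableSet A)
    (hB : MeasurableSet B) (hA' : A.Nonempty) (hB' : B.Nonempty)
    (h : ∀ x ∈ A, ∀ y ∈ B, (1 / 2 : ℝ) • (x + y) ∈ C) :
    volume A + volume B ≤ 2 * volume C := by
  have key : ∀ K ⊆ A, IsCompact K → ∀ L ⊆ B, IsCompact L → volume K + volume L ≤ 2 * volume C := by
    have main : ∀ K ⊆ A, IsCompact K → K.Nonempty → ∀ L ⊆ B, IsCompact L → L.Nonempty →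
        volume K + volume L ≤ 2 * volume C := by
      intro K hK hKc hKn L hL hLc hLn
      -- The half-scale copies `(K + m)/2` and `(M + L)/2` both lie in `C` and sit on opposite sides
      -- of `(M + m)/2`, so their measures add up.
      obtain ⟨M, hMK, hM⟩ := hKc.exists_isGreatest hKn
      obtain ⟨m, hmL, hm⟩ := hLc.exists_isLeast hLn
      have hvol : ∀ (D : Set ℝ) (a : ℝ),
          volume ((fun x => (1 / 2 : ℝ) • (x + a)) ⁻¹' D) = 2 * volume D := by
        intro D a
        have : (fun x : ℝ => (1 / 2 : ℝ) • (x + a)) ⁻¹' D =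
            (fun x => x + a) ⁻¹' ((fun x => (1 / 2 : ℝ) * x) ⁻¹' D) := rfl
        rw [this, measure_preimage_add_right, Real.volume_preimage_mul_left (by norm_num)]
        norm_num
      have h1 : K ⊆ (fun x => (1 / 2 : ℝ) • (x + m)) ⁻¹' (C ∩ Iic ((1 / 2 : ℝ) • (M + m))) := by
        intro x hx
        refine ⟨h x (hK hx) m (hL hmL), ?_⟩
        have := hM hx
        simp only [smul_eq_mul, mem_Iic]; linarith
      have h2 : L ⊆ (fun y => (1 / 2 : ℝ) • (y + M)) ⁻¹' (C ∩ Ici ((1 / 2 : ℝ) • (M + m))) := by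
        intro y hy
        refine ⟨by simpa [add_comm] using h M (hK hMK) y (hL hy), ?_⟩
        have := hm hy
        simp only [smul_eq_mul, mem_Ici]; linarith
      have h3 : volume (C ∩ Ici ((1 / 2 : ℝ) • (M + m))) =
          volume (C \ Iic ((1 / 2 : ℝ) • (M + m))) := by
        rw [sdiff_eq, compl_Iic]
        exact measure_congr ((ae_eq_refl C).inter Ioi_ae_eq_Ici.symm)
      calc volume K + volume L
          ≤ 2 * volume (C ∩ Iic ((1 / 2 : ℝ) • (M + m))) +
              2 * volume (C ∩ Ici ((1 / 2 : ℝ) • (M + m))) := by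
            rw [← hvol _ m, ← hvol _ M]
            exact add_le_add (measure_mono h1) (measure_mono h2)
        _ = 2 * volume C := by
            rw [h3, ← mul_add, measure_inter_add_sdiff _ measurableSet_Iic]
    intro K hK hKc L hL hLc
    obtain ⟨a, ha⟩ := hA'
    obtain ⟨b, hb⟩ := hB'
    -- Adjoining a point of `A` and one of `B` makes the compact sets nonempty.
    refine (add_le_add (measure_mono (subset_insert a K)) (measure_mono (subset_insert b L))).trans
      (main _ (insert_subset ha hK) (hKc.insert a) (insert_nonempty _ _) _ (insert_subset hb hL)
        (hLc.insert b) (insert_nonempty _ _))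
  rw [hA.measure_eq_iSup_isCompact, hB.measure_eq_iSup_isCompact]
  simp only [iSup_and']
  exact ENNReal.biSup_add_biSup_le' ⟨∅, empty_subset _, isCompact_empty⟩
    ⟨∅, empty_subset _, isCompact_empty⟩ fun K hK L hL => key K hK.1 hK.2 L hL.1 hL.2

theorem four_mul_mul_le_add_sq (x y : ℝ≥0∞) : 4 * (x * y) ≤ (x + y) ^ 2 := by
  rcases eq_or_ne x ∞ with rfl | hx
  · simp
  rcases eq_or_ne y ∞ with rfl | hy
  · simp
  lift x to ℝ≥0 using hx
  lift y to ℝ≥0 using hy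
  norm_cast
  rw [← mul_assoc]
  exact four_mul_le_pow_two_add x y

/-- A measure satisfies the midpoint Prékopa–Leindler inequality if
`(∫ f) (∫ g) ≤ (∫ h)²` whenever `f x * g y ≤ h ((x + y) / 2) ^ 2` and `f, g ≤ 1`. -/
def MidpointPL {α : Type*} [AddCommGroup α] [Module ℝ α] [MeasurableSpace α]
    (μ : Measure α) : Prop :=
  ∀ f g h : α → ℝ≥0∞, Measurable f → Measurable g → Measurable h → (∀ x, f x ≤ 1) →
    (∀ x, g x ≤ 1) → (∀ x y, f x * g y ≤ h ((1 / 2 : ℝ) • (x + y)) ^ 2) →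
    (∫⁻ x, f x ∂μ) * (∫⁻ x, g x ∂μ) ≤ (∫⁻ x, h x ∂μ) ^ 2

theorem lintegral_eq_lintegral_meas_lt_toReal {α : Type*} [MeasurableSpace α] (μ : Measure α)
    {f : α → ℝ≥0∞} (hf : Measurable f) (hf1 : ∀ x, f x ≤ 1) :
    ∫⁻ x, f x ∂μ = ∫⁻ t in Ioi (0 : ℝ), μ {x | t < (f x).toReal} := by
  rw [← lintegral_eq_lintegral_meas_lt μ (ae_of_all _ fun x => ENNReal.toReal_nonneg)
    hf.ennreal_toReal.aemeasurable]
  refine lintegral_congr fun x => (ENNReal.ofReal_toReal ?_).symm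
  exact ne_top_of_le_ne_top ENNReal.one_ne_top (hf1 x)

/-- Brunn–Minkowski applies to the superlevel sets at each height `t`, and the layer cake formula
integrates over `t`. Brunn–Minkowski needs nonempty sets, which is why `f` and `g` must come
arbitrarily close to `1`. -/
theorem lintegral_add_lintegral_le_of_midpoint {f g h : ℝ → ℝ≥0∞} (hf : Measurable f)
    (hg : Measurable g) (hh : Measurable h) (hf1 : ∀ x, f x ≤ 1) (hg1 : ∀ x, g x ≤ 1)
    (hf' : ∀ t < 1, ∃ x, t < f x) (hg' : ∀ t < 1, ∃ x, t < g x)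
    (H : ∀ x y, f x * g y ≤ h ((1 / 2 : ℝ) • (x + y)) ^ 2) :
    (∫⁻ x, f x) + ∫⁻ x, g x ≤ 2 * ∫⁻ x, h x := by
  -- Truncation makes the layer cake formula available for `h`; only heights below `1` matter.
  have hmin : ∫⁻ x, min (h x) 1 ≤ ∫⁻ x, h x := lintegral_mono fun x => min_le_left _ _
  refine le_trans ?_ (mul_le_mul_right hmin 2)
  have hm : Measurable fun x => min (h x) 1 := hh.min measurable_const
  have hm1 : ∀ x, min (h x) 1 ≤ 1 := fun x => min_le_right _ _
  have meas : ∀ {F : ℝ → ℝ≥0∞}, Measurable F → Measurable fun t : ℝ =>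
      volume {x | t < (F x).toReal} := fun {F} hF =>
    (Antitone.measurable fun s t hst => measure_mono fun x hx => lt_of_le_of_lt hst hx)
  rw [lintegral_eq_lintegral_meas_lt_toReal _ hf hf1, lintegral_eq_lintegral_meas_lt_toReal _ hg hg1,
    lintegral_eq_lintegral_meas_lt_toReal _ hm hm1, ← lintegral_add_left (meas hf),
    ← lintegral_const_mul _ (meas hm)]
  refine setLIntegral_mono' measurableSet_Ioi fun t ht => ?_
  have ht0 : 0 ≤ t := le_of_lt ht
  have iff_lt : ∀ {F : ℝ → ℝ≥0∞}, (∀ x, F x ≤ 1) → ∀ x, t < (F x).toReal ↔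
      ENNReal.ofReal t < F x := fun {F} hF x =>
    (ENNReal.ofReal_lt_iff_lt_toReal ht0 (ne_top_of_le_ne_top ENNReal.one_ne_top (hF x))).symm
  simp only [iff_lt hf1, iff_lt hg1, iff_lt hm1]
  rcases lt_or_ge (ENNReal.ofReal t) 1 with h1 | h1
  · refine volume_add_volume_le_of_midpoint (measurableSet_lt measurable_const hf)
      (measurableSet_lt measurable_const hg)
      (hf' _ h1) (hg' _ h1) fun x hx y hy => ?_
    have h2 : ENNReal.ofReal t ^ 2 < h ((1 / 2 : ℝ) • (x + y)) ^ 2 := by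
      refine lt_of_lt_of_le ?_ (H x y)
      rw [sq]
      exact ENNReal.mul_lt_mul hx hy
    exact lt_min (lt_of_pow_lt_pow_left' 2 h2) h1
  · have e1 : ∀ {F : ℝ → ℝ≥0∞}, (∀ x, F x ≤ 1) → {x | ENNReal.ofReal t < F x} = ∅ := by
      intro F hF
      ext x
      simpa using (hF x).trans h1
    simp [e1 hf1, e1 hg1]

/-- Normalizing `f` and `g` to supremum `1` gives the additive inequality, and the
arithmetic-geometric mean inequality turns the sum into a product. -/
theorem midpointPL_volume : MidpointPL (volume : Measure ℝ) := by
  intro f g h hf hg hh hf1 hg1 H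
  set a := ⨆ x, f x with ha
  set b := ⨆ x, g x with hb
  have ha1 : a ≠ ∞ := ne_top_of_le_ne_top ENNReal.one_ne_top (iSup_le hf1)
  have hb1 : b ≠ ∞ := ne_top_of_le_ne_top ENNReal.one_ne_top (iSup_le hg1)
  rcases eq_or_ne a 0 with ha0 | ha0
  · have : ∀ x, f x = 0 := fun x => le_antisymm (ha0 ▸ le_iSup f x) bot_le
    simp [this]
  rcases eq_or_ne b 0 with hb0 | hb0
  · have : ∀ x, g x = 0 := fun x => le_antisymm (hb0 ▸ le_iSup g x) bot_le
    simp [this]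
  -- The geometric mean of the suprema is the scale for `h` that preserves the midpoint hypothesis.
  set c : ℝ≥0∞ := (a * b) ^ (1 / 2 : ℝ) with hc
  have hc2 : c ^ 2 = a * b := by
    rw [hc, ← ENNReal.rpow_natCast, ← ENNReal.rpow_mul]; norm_num
  have hc0 : c ≠ 0 := fun h0 => by
    rw [h0] at hc2; simp at hc2; tauto
  have hct : c ≠ ∞ := fun h0 => by
    rw [h0] at hc2; exact ENNReal.mul_ne_top ha1 hb1 (by simpa using hc2.symm)
  have sup1 : ∀ {F : ℝ → ℝ≥0∞}, (⨆ x, F x) ≠ 0 → (⨆ x, F x) ≠ ∞ →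
      (∀ x, (⨆ x, F x)⁻¹ * F x ≤ 1) ∧ ∀ t < 1, ∃ x, t < (⨆ x, F x)⁻¹ * F x := by
    intro F h0 h1
    refine ⟨fun x => ?_, fun t ht => ?_⟩
    · rw [mul_comm, ← div_eq_mul_inv]
      exact ENNReal.div_le_of_le_mul (by simpa using le_iSup F x)
    · rw [← lt_iSup_iff, ← ENNReal.mul_iSup, ENNReal.inv_mul_cancel h0 h1]
      exact ht
  obtain ⟨f1, f2⟩ := sup1 ha0 ha1
  obtain ⟨g1, g2⟩ := sup1 hb0 hb1
  have key := lintegral_add_lintegral_le_of_midpoint (hf.const_mul a⁻¹) (hg.const_mul b⁻¹)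
    (hh.const_mul c⁻¹) f1 g1 f2 g2 (fun x y => by
      rw [mul_pow, ← ENNReal.inv_pow, hc2, ENNReal.mul_inv (Or.inl ha0) (Or.inl ha1)]
      calc a⁻¹ * f x * (b⁻¹ * g y) = a⁻¹ * b⁻¹ * (f x * g y) := by ring
        _ ≤ _ := by gcongr; exact H x y)
  rw [lintegral_const_mul _ hf, lintegral_const_mul _ hg, lintegral_const_mul _ hh] at key
  set u := ∫⁻ x, f x
  set v := ∫⁻ x, g x
  set w := ∫⁻ x, h x
  have amgm : 4 * ((a⁻¹ * u) * (b⁻¹ * v)) ≤ (a⁻¹ * u + b⁻¹ * v) ^ 2 := by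
    exact four_mul_mul_le_add_sq _ _
  have h4 : 4 * ((a⁻¹ * u) * (b⁻¹ * v)) ≤ 4 * (c⁻¹ * w) ^ 2 := by
    refine amgm.trans ((pow_le_pow_left' key 2).trans_eq ?_)
    ring
  have h5 := (ENNReal.mul_le_mul_iff_right (by norm_num) (by norm_num)).1 h4
  calc u * v = (a * a⁻¹) * (b * b⁻¹) * (u * v) := by
        rw [ENNReal.mul_inv_cancel ha0 ha1, ENNReal.mul_inv_cancel hb0 hb1]; simp
    _ = c ^ 2 * (a⁻¹ * u * (b⁻¹ * v)) := by rw [hc2]; ring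
    _ ≤ c ^ 2 * (c⁻¹ * w) ^ 2 := by gcongr
    _ = (c * c⁻¹) ^ 2 * w ^ 2 := by ring
    _ = w ^ 2 := by rw [ENNReal.mul_inv_cancel hc0 hct]; simp

/-- Log-concavity of the density lets it be absorbed into the three functions. -/
theorem midpointPL_gaussianReal : MidpointPL (gaussianReal 0 1) := by
  intro f g h hf hg hh hf1 hg1 H
  rw [gaussianReal_of_var_ne_zero _ one_ne_zero]
  have hm := measurable_gaussianPDF 0 1
  rw [lintegral_withDensity_eq_lintegral_mul _ hm hf, lintegral_withDensity_eq_lintegral_mul _ hm hg,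
    lintegral_withDensity_eq_lintegral_mul _ hm hh]
  -- The peak `1/√(2π)` is below `1`, so the products with the density keep the bound that
  -- `MidpointPL` demands.
  have hle : ∀ x, gaussianPDF 0 1 x ≤ 1 := by
    intro x
    rw [gaussianPDF, ENNReal.ofReal_le_one, gaussianPDFReal]
    have h1 : (1 : ℝ) ≤ √(2 * Real.pi * (1 : ℝ≥0)) := by
      rw [Real.one_le_sqrt]; have := Real.pi_gt_three; push_cast; linarith
    exact mul_le_one₀ (inv_le_one_of_one_le₀ h1) (Real.exp_pos _).le
      (Real.exp_le_one_iff.2 (by rw [neg_div]; simp; positivity))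
  refine midpointPL_volume _ _ _ (hm.mul hf) (hm.mul hg) (hm.mul hh)
    (fun x => mul_le_one' (hle x) (hf1 x)) (fun x => mul_le_one' (hle x) (hg1 x)) fun x y => ?_
  have hφ : gaussianPDF 0 1 x * gaussianPDF 0 1 y ≤
      gaussianPDF 0 1 ((1 / 2 : ℝ) • (x + y)) ^ 2 := by
    simp only [gaussianPDF, gaussianPDFReal]
    rw [← ENNReal.ofReal_mul (by positivity), ← ENNReal.ofReal_pow (by positivity)]
    refine ENNReal.ofReal_le_ofReal ?_
    rw [mul_mul_mul_comm, mul_pow, sq (√_)⁻¹, ← Real.exp_add, ← Real.exp_nat_mul]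
    gcongr
    simp only [smul_eq_mul, NNReal.coe_one]
    push_cast
    nlinarith [sq_nonneg (x - y)]
  simp only [Pi.mul_apply]
  calc gaussianPDF 0 1 x * f x * (gaussianPDF 0 1 y * g y)
      = gaussianPDF 0 1 x * gaussianPDF 0 1 y * (f x * g y) := by ring
    _ ≤ _ := by rw [mul_pow]; exact mul_le_mul' hφ (H x y)

theorem MidpointPL.map {α β : Type*} [AddCommGroup α] [Module ℝ α] [MeasurableSpace α]
    [AddCommGroup β] [Module ℝ β] [MeasurableSpace β] {μ : Measure α} (hμ : MidpointPL μ)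
    {T : α → β} (hT : Measurable T)
    (hTm : ∀ x y, T ((1 / 2 : ℝ) • (x + y)) = (1 / 2 : ℝ) • (T x + T y)) :
    MidpointPL (μ.map T) := by
  intro f g h hf hg hh hf1 hg1 H
  rw [lintegral_map hf hT, lintegral_map hg hT, lintegral_map hh hT]
  exact hμ _ _ _ (hf.comp hT) (hg.comp hT) (hh.comp hT) (fun x => hf1 _) (fun x => hg1 _)
    fun x y => by simpa only [Function.comp, hTm] using H (T x) (T y)

/-- The inequality on the fibres is exactly the hypothesis for the partial integrals on the base;
these stay at most `1` because `ν` is a probability measure. -/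
theorem MidpointPL.prod {α β : Type*} [AddCommGroup α] [Module ℝ α] [MeasurableSpace α]
    [AddCommGroup β] [Module ℝ β] [MeasurableSpace β] {μ : Measure α} {ν : Measure β}
    [IsProbabilityMeasure ν] (hμ : MidpointPL μ) (hν : MidpointPL ν) :
    MidpointPL (μ.prod ν) := by
  intro f g h hf hg hh hf1 hg1 H
  rw [lintegral_prod _ hf.aemeasurable, lintegral_prod _ hg.aemeasurable,
    lintegral_prod _ hh.aemeasurable]
  have hle : ∀ {F : α × β → ℝ≥0∞}, (∀ x, F x ≤ 1) → ∀ x, ∫⁻ y, F (x, y) ∂ν ≤ 1 := fun hF x =>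
    (lintegral_mono fun y => hF (x, y)).trans (by simp)
  refine hμ _ _ _ hf.lintegral_prod_right' hg.lintegral_prod_right' hh.lintegral_prod_right'
    (hle hf1) (hle hg1) fun x x' => ?_
  exact hν _ _ _ (hf.comp measurable_prodMk_left) (hg.comp measurable_prodMk_left)
    (hh.comp measurable_prodMk_left) (fun y => hf1 _) (fun y => hg1 _) fun y y' => H (x, y) (x', y')

theorem midpointPL_dirac {α : Type*} [AddCommGroup α] [Module ℝ α] [MeasurableSpace α] (a : α) :
    MidpointPL (Measure.dirac a) := by
  intro f g h hf hg hh hf1 hg1 H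
  rw [lintegral_dirac' _ hf, lintegral_dirac' _ hg, lintegral_dirac' _ hh]
  have h2 : (1 / 2 : ℝ) • (a + a) = a := by rw [← two_smul ℝ, smul_smul]; norm_num
  simpa only [h2] using H a a

theorem midpointPL_pi_gaussianReal (n : ℕ) :
    MidpointPL (Measure.pi fun _ : Fin n => gaussianReal 0 1) := by
  induction n with
  | zero => rw [Measure.pi_of_empty]; exact midpointPL_dirac _
  | succ n ih =>
    have hp := (measurePreserving_piFinSuccAbove (fun _ : Fin (n + 1) => gaussianReal 0 1) 0).symm
    rw [← hp.map_eq]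
    refine (midpointPL_gaussianReal.prod ih).map hp.measurable fun x y => ?_
    ext i
    refine Fin.cases ?_ (fun i => ?_) i
    · simp [MeasurableEquiv.piFinSuccAbove, mul_add]
    · simp [MeasurableEquiv.piFinSuccAbove, mul_add]

section Gaussian

variable {E : Type*} [NormedAddCommGroup E] [InnerProductSpace ℝ E] [FiniteDimensional ℝ E]
  [MeasurableSpace E] [BorelSpace E]

theorem midpointPL_stdGaussian : MidpointPL (stdGaussian E) := by
  refine (midpointPL_pi_gaussianReal _).map (by fun_prop) fun x y => ?_
  simp only [Pi.smul_apply, Pi.add_apply, smul_eq_mul, mul_smul, add_smul, Finset.sum_add_distrib,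
    Finset.smul_sum, smul_add]

theorem map_neg_stdGaussian : (stdGaussian E).map (fun x => -x) = stdGaussian E :=
  stdGaussian_map (LinearIsometryEquiv.neg ℝ)

end Gaussian

/-- The Anderson inequality: translating a symmetric convex set away from the origin decreases its
measure. -/
theorem MidpointPL.anderson {α : Type*} [AddCommGroup α] [Module ℝ α] [MeasurableSpace α]
    [MeasurableAdd α] [MeasurableNeg α] {μ : Measure α} (hμ : MidpointPL μ)
    (hneg : μ.map (fun x => -x) = μ) {K : Set α} (hK : MeasurableSet K) (hconv : Convex ℝ K)
    (hsymm : ∀ x ∈ K, -x ∈ K) (a : α) : μ ((fun x => a + x) ⁻¹' K) ≤ μ K := by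
  have hm : ∀ b : α, MeasurableSet ((fun x => b + x) ⁻¹' K) := fun b => measurable_const_add b hK
  have hone : ∀ (S : Set α) (x : α), S.indicator (1 : α → ℝ≥0∞) x ≤ 1 := fun S x =>
    indicator_le_self' (fun _ _ => zero_le) x
  -- Midpoints between `K - a` and `K + a` lie in `K` by convexity. The two translates have equal
  -- measure by symmetry, so the inequality becomes a comparison of squares.
  have key := hμ (((fun x => a + x) ⁻¹' K).indicator 1) (((fun x => -a + x) ⁻¹' K).indicator 1)
    (K.indicator 1) (measurable_one.indicator (hm _)) (measurable_one.indicator (hm _))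
    (measurable_one.indicator hK) (hone _) (hone _) (fun x y => by
      by_cases hx : a + x ∈ K
      · by_cases hy : -a + y ∈ K
        · have : (1 / 2 : ℝ) • (x + y) ∈ K := by
            have := hconv hx hy (a := 1 / 2) (b := 1 / 2) (by norm_num) (by norm_num) (by norm_num)
            rw [← smul_add] at this
            convert this using 2
            abel
          simp only [indicator, mem_preimage, hx, hy, this, if_true]; simp
        · simp [indicator, hy]
      · simp [indicator, hx])
  rw [lintegral_indicator_one (hm _), lintegral_indicator_one (hm _),
    lintegral_indicator_one hK] at key
  have hsym : μ ((fun x => -a + x) ⁻¹' K) = μ ((fun x => a + x) ⁻¹' K) := by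
    conv_lhs => rw [← hneg]
    rw [Measure.map_apply measurable_neg (hm _)]
    congr 1
    ext x
    simp only [mem_preimage]
    constructor
    · intro h
      simpa [add_comm] using hsymm _ h
    · intro h
      simpa [add_comm] using hsymm _ h
  rw [hsym, ← sq] at key
  exact (ENNReal.pow_le_pow_left_iff two_ne_zero).1 key

/-! ### Convexity, symmetry and compact sublevel sets of the excess error -/

section Excess

variable {d : ℕ} {PX : Measure (EuclideanSpace ℝ (Fin d))}
  {σsq : ℝ≥0} {e : ℝ → ℝ}

theorem convexOn_tildeE (he : ConvexOn ℝ univ e)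
    (hfin : ∀ Δ : EuclideanSpace ℝ (Fin d),
      Integrable (fun q : EuclideanSpace ℝ (Fin d) × ℝ => e (⟪Δ, q.1⟫_ℝ + q.2))
        (PX.prod (gaussianReal 0 σsq))) :
    ConvexOn ℝ univ (tildeE e PX σsq) := by
  refine ⟨convex_univ, fun x _ y _ a b ha hb hab => ?_⟩
  simp only [tildeE, smul_eq_mul]
  rw [← integral_const_mul, ← integral_const_mul, ← integral_add ((hfin x).const_mul a)
    ((hfin y).const_mul b)]
  refine integral_mono (hfin _) (((hfin x).const_mul a).add ((hfin y).const_mul b)) fun q => ?_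
  have h := he.2 (mem_univ (⟪x, q.1⟫_ℝ + q.2)) (mem_univ (⟪y, q.1⟫_ℝ + q.2)) ha hb hab
  simp only [smul_eq_mul] at h
  refine le_trans (le_of_eq ?_) h
  congr 1
  simp only [inner_add_left, real_inner_smul_left]
  linear_combination (-q.2) * hab

theorem continuous_tildeExcess (he : ConvexOn ℝ univ e)
    (hfin : ∀ Δ : EuclideanSpace ℝ (Fin d),
      Integrable (fun q : EuclideanSpace ℝ (Fin d) × ℝ => e (⟪Δ, q.1⟫_ℝ + q.2))
        (PX.prod (gaussianReal 0 σsq))) : Continuous (tildeExcess e PX σsq) := by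
  have h : Continuous (tildeE e PX σsq) :=
    continuousOn_univ.1 ((convexOn_tildeE he hfin).continuousOn isOpen_univ)
  exact h.sub continuous_const

theorem convex_tildeExcess_le (he : ConvexOn ℝ univ e)
    (hfin : ∀ Δ : EuclideanSpace ℝ (Fin d),
      Integrable (fun q : EuclideanSpace ℝ (Fin d) × ℝ => e (⟪Δ, q.1⟫_ℝ + q.2))
        (PX.prod (gaussianReal 0 σsq))) (t : ℝ) : Convex ℝ {Δ | tildeExcess e PX σsq Δ ≤ t} := by
  have := (convexOn_tildeE he hfin).convex_le (t + tildeE e PX σsq 0)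
  simpa [tildeExcess] using this

variable [IsProbabilityMeasure PX]

theorem measurePreserving_prod_neg :
    MeasurePreserving (fun q : EuclideanSpace ℝ (Fin d) × ℝ => (q.1, -q.2))
      (PX.prod (gaussianReal 0 σsq)) (PX.prod (gaussianReal 0 σsq)) := by
  have h : MeasurePreserving (fun y : ℝ => -y) (gaussianReal 0 σsq) (gaussianReal 0 σsq) :=
    ⟨measurable_neg, by rw [gaussianReal_map_neg, neg_zero]⟩
  exact (MeasurePreserving.id PX).prod h

theorem tildeE_eq_integral_sub (he_meas : Measurable e) (Δ : EuclideanSpace ℝ (Fin d)) :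
    ∫ q, e (⟪Δ, q.1⟫_ℝ - q.2) ∂(PX.prod (gaussianReal 0 σsq)) = tildeE e PX σsq Δ := by
  conv_rhs => rw [tildeE, ← measurePreserving_prod_neg.map_eq]
  have hm : Measurable fun q : EuclideanSpace ℝ (Fin d) × ℝ => e (⟪Δ, q.1⟫_ℝ + q.2) :=
    he_meas.comp (by fun_prop)
  rw [integral_map (by fun_prop) hm.aestronglyMeasurable]
  simp [sub_eq_add_neg]

/-- Negating the whole argument of `e` moves the sign to the noise, whose law is symmetric. -/
theorem tildeE_neg (he_meas : Measurable e) (he_symm : ∀ t, e (-t) = e t)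
    (Δ : EuclideanSpace ℝ (Fin d)) : tildeE e PX σsq (-Δ) = tildeE e PX σsq Δ := by
  rw [← tildeE_eq_integral_sub he_meas Δ, tildeE]
  refine integral_congr_ae (ae_of_all _ fun q => ?_)
  simp only [inner_neg_left]
  rw [← he_symm]
  congr 1; ring

theorem tildeE_zero_le (he : ConvexOn ℝ univ e) (he_meas : Measurable e)
    (he_symm : ∀ t, e (-t) = e t)
    (hfin : ∀ Δ : EuclideanSpace ℝ (Fin d),
      Integrable (fun q : EuclideanSpace ℝ (Fin d) × ℝ => e (⟪Δ, q.1⟫_ℝ + q.2))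
        (PX.prod (gaussianReal 0 σsq))) (Δ : EuclideanSpace ℝ (Fin d)) :
    tildeE e PX σsq 0 ≤ tildeE e PX σsq Δ := by
  have h := (convexOn_tildeE he hfin).2 (mem_univ Δ) (mem_univ (-Δ))
    (by norm_num : (0 : ℝ) ≤ 1 / 2) (by norm_num : (0 : ℝ) ≤ 1 / 2) (by norm_num)
  rw [tildeE_neg he_meas he_symm, smul_neg, add_neg_cancel] at h
  simp only [smul_eq_mul] at h
  linarith

/-- In case of equality the midpoint convexity gap `F` between `Δ` and `-Δ` is nonnegative with
integral zero. Strict convexity then forces `⟪Δ, X⟫ = 0` almost surely, which puts the support in a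
closed hyperplane. -/
theorem tildeE_zero_lt (he : StrictConvexOn ℝ univ e) (he_meas : Measurable e)
    (he_symm : ∀ t, e (-t) = e t)
    (hPX : ∀ w : EuclideanSpace ℝ (Fin d), w ≠ 0 → ¬ PX.support ⊆ {x | ⟪w, x⟫_ℝ = 0})
    (hfin : ∀ Δ : EuclideanSpace ℝ (Fin d),
      Integrable (fun q : EuclideanSpace ℝ (Fin d) × ℝ => e (⟪Δ, q.1⟫_ℝ + q.2))
        (PX.prod (gaussianReal 0 σsq))) {Δ : EuclideanSpace ℝ (Fin d)} (hΔ : Δ ≠ 0) :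
    tildeE e PX σsq 0 < tildeE e PX σsq Δ := by
  refine lt_of_le_of_ne (tildeE_zero_le he.convexOn he_meas he_symm hfin Δ) fun heq => ?_
  set F : EuclideanSpace ℝ (Fin d) × ℝ → ℝ := fun q =>
    (1 / 2) * e (⟪Δ, q.1⟫_ℝ + q.2) + (1 / 2) * e (⟪-Δ, q.1⟫_ℝ + q.2) -
      e (⟪(0 : EuclideanSpace ℝ (Fin d)), q.1⟫_ℝ + q.2) with hF
  have hmid : ∀ q : EuclideanSpace ℝ (Fin d) × ℝ,
      (1 / 2 : ℝ) • (⟪Δ, q.1⟫_ℝ + q.2) + (1 / 2 : ℝ) • (⟪-Δ, q.1⟫_ℝ + q.2) =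
        ⟪(0 : EuclideanSpace ℝ (Fin d)), q.1⟫_ℝ + q.2 := by
    intro q
    simp only [inner_neg_left, inner_zero_left, smul_eq_mul]; ring
  have hF0 : 0 ≤ F := fun q => by
    have := he.convexOn.2 (mem_univ (⟪Δ, q.1⟫_ℝ + q.2)) (mem_univ (⟪-Δ, q.1⟫_ℝ + q.2))
      (by norm_num : (0 : ℝ) ≤ 1 / 2) (by norm_num : (0 : ℝ) ≤ 1 / 2) (by norm_num)
    rw [hmid] at this
    simp only [smul_eq_mul] at this
    simp only [Pi.zero_apply, hF]; linarith
  have h2 := ((hfin Δ).const_mul (1 / 2)).add ((hfin (-Δ)).const_mul (1 / 2))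
  have hFi : Integrable F (PX.prod (gaussianReal 0 σsq)) := h2.sub (hfin 0)
  have hint : ∫ q, F q ∂(PX.prod (gaussianReal 0 σsq)) = 0 := by
    have e1 : ∫ q, F q ∂(PX.prod (gaussianReal 0 σsq)) =
        (1 / 2) * tildeE e PX σsq Δ + (1 / 2) * tildeE e PX σsq (-Δ) - tildeE e PX σsq 0 := by
      simp only [tildeE]
      rw [← integral_const_mul, ← integral_const_mul, ← integral_add ((hfin Δ).const_mul _)
        ((hfin (-Δ)).const_mul _)]
      exact integral_sub h2 (hfin 0)
    rw [e1, tildeE_neg he_meas he_symm, heq]; ring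
  have hae := (integral_eq_zero_iff_of_nonneg hF0 hFi).1 hint
  have hz : ∀ q, F q = 0 → ⟪Δ, q.1⟫_ℝ = 0 := by
    intro q hq
    by_contra hne
    have := he.2 (mem_univ (⟪Δ, q.1⟫_ℝ + q.2)) (mem_univ (⟪-Δ, q.1⟫_ℝ + q.2))
      (fun h => hne (by simp only [inner_neg_left] at h; linarith))
      (by norm_num : (0 : ℝ) < 1 / 2) (by norm_num : (0 : ℝ) < 1 / 2) (by norm_num)
    rw [hmid] at this
    simp only [smul_eq_mul] at this
    simp only [hF] at hq; linarith
  have hae2 : ∀ᵐ q ∂(PX.prod (gaussianReal 0 σsq)), ⟪Δ, q.1⟫_ℝ = 0 := by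
    filter_upwards [hae] with q hq using hz q hq
  have hae3 : ∀ᵐ x ∂PX, ⟪Δ, x⟫_ℝ = 0 := by
    have := Measure.ae_ae_of_ae_prod hae2
    filter_upwards [this] with x hx
    exact hx.exists.choose_spec
  exact hPX Δ hΔ (Measure.support_subset_of_isClosed
    (isClosed_eq (by fun_prop) continuous_const) hae3)

/-- The excess has a positive minimum `c` on the unit sphere, and convexity along rays from `0`
makes it grow at least like `c ‖Δ‖` outside the unit ball. -/
theorem isCompact_tildeExcess_le (he : StrictConvexOn ℝ univ e) (he_meas : Measurable e)
    (he_symm : ∀ t, e (-t) = e t)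
    (hPX : ∀ w : EuclideanSpace ℝ (Fin d), w ≠ 0 → ¬ PX.support ⊆ {x | ⟪w, x⟫_ℝ = 0})
    (hfin : ∀ Δ : EuclideanSpace ℝ (Fin d),
      Integrable (fun q : EuclideanSpace ℝ (Fin d) × ℝ => e (⟪Δ, q.1⟫_ℝ + q.2))
        (PX.prod (gaussianReal 0 σsq))) (t : ℝ) :
    IsCompact {Δ | tildeExcess e PX σsq Δ ≤ t} := by
  have hcont := continuous_tildeExcess he.convexOn hfin
  refine Metric.isCompact_of_isClosed_isBounded (isClosed_le hcont continuous_const) ?_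
  -- The sphere is empty exactly when `d = 0`, where the whole space is a point.
  rcases (Metric.sphere (0 : EuclideanSpace ℝ (Fin d)) 1).eq_empty_or_nonempty with hs | hs
  · have : Subsingleton (EuclideanSpace ℝ (Fin d)) := by
      by_contra hns
      rw [not_subsingleton_iff_nontrivial] at hns
      exact (NormedSpace.sphere_nonempty.2 zero_le_one).ne_empty hs
    exact (Set.subsingleton_of_subsingleton).finite.isBounded
  obtain ⟨u, hu, hmin⟩ := (isCompact_sphere (0 : EuclideanSpace ℝ (Fin d)) 1).exists_isMinOn hs
    hcont.continuousOn
  have hu0 : u ≠ 0 := fun h => by simp [h] at hu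
  have hc : 0 < tildeExcess e PX σsq u :=
    sub_pos.2 (tildeE_zero_lt he he_meas he_symm hPX hfin hu0)
  set c := tildeExcess e PX σsq u
  refine (isBounded_iff_forall_norm_le.2 ⟨max 1 (t / c), fun Δ hΔ => ?_⟩)
  by_contra! hlt
  have h1 : 1 < ‖Δ‖ := (le_max_left _ _).trans_lt hlt
  have h2 : t / c < ‖Δ‖ := (le_max_right _ _).trans_lt hlt
  have hn : 0 < ‖Δ‖ := by linarith
  have hsph : ‖Δ‖⁻¹ • Δ ∈ Metric.sphere (0 : EuclideanSpace ℝ (Fin d)) 1 := by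
    simp [norm_smul, hn.ne']
  have h3 : c ≤ tildeExcess e PX σsq (‖Δ‖⁻¹ • Δ) := hmin hsph
  have h4 := (convexOn_tildeE he.convexOn hfin).2 (mem_univ Δ) (mem_univ 0)
    (by positivity : 0 ≤ ‖Δ‖⁻¹) (sub_nonneg.2 (inv_le_one_of_one_le₀ h1.le)) (by ring)
  simp only [smul_zero, add_zero, smul_eq_mul] at h4
  have h5 : tildeExcess e PX σsq (‖Δ‖⁻¹ • Δ) ≤ ‖Δ‖⁻¹ * tildeExcess e PX σsq Δ := by
    simp only [tildeExcess]; linarith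
  have h6 : ‖Δ‖⁻¹ * tildeExcess e PX σsq Δ ≤ ‖Δ‖⁻¹ * t :=
    mul_le_mul_of_nonneg_left hΔ (by positivity)
  have h7 : ‖Δ‖⁻¹ * t < c := by
    rw [inv_mul_eq_div, div_lt_iff₀ hn]
    rwa [div_lt_iff₀ hc, mul_comm] at h2
  linarith

theorem tildeExcess_neg (he_meas : Measurable e) (he_symm : ∀ t, e (-t) = e t)
    (Δ : EuclideanSpace ℝ (Fin d)) : tildeExcess e PX σsq (-Δ) = tildeExcess e PX σsq Δ := by
  simp only [tildeExcess, tildeE_neg he_meas he_symm]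

/-- The law of `(X, ⟪w, X⟫ + η)`, `(X, η) ∼ P_X × N(0, σ²)`. -/
noncomputable def gaussLaw (PX : Measure (EuclideanSpace ℝ (Fin d))) (σsq : ℝ≥0)
    (w : EuclideanSpace ℝ (Fin d)) : Measure (EuclideanSpace ℝ (Fin d) × ℝ) :=
  (PX.prod (gaussianReal 0 σsq)).map (fun q => (q.1, ⟪w, q.1⟫_ℝ + q.2))

theorem expectedError_gaussLaw (he_meas : Measurable e) (w v : EuclideanSpace ℝ (Fin d)) :
    expectedError e (gaussLaw PX σsq w) v = tildeE e PX σsq (v - w) := by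
  have hm : Measurable fun q : EuclideanSpace ℝ (Fin d) × ℝ => e (⟪v, q.1⟫_ℝ - q.2) :=
    he_meas.comp (by fun_prop)
  rw [← tildeE_eq_integral_sub he_meas, expectedError, gaussLaw,
    integral_map (by fun_prop) hm.aestronglyMeasurable]
  refine integral_congr_ae (ae_of_all _ fun q => ?_)
  simp only [inner_sub_left]
  congr 1; ring

/-- The best predictor is the true parameter, so the risk depends only on the deviation from it. -/
theorem excessError_gaussLaw (he : ConvexOn ℝ univ e) (he_meas : Measurable e)
    (he_symm : ∀ t, e (-t) = e t)
    (hfin : ∀ Δ : EuclideanSpace ℝ (Fin d),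
      Integrable (fun q : EuclideanSpace ℝ (Fin d) × ℝ => e (⟪Δ, q.1⟫_ℝ + q.2))
        (PX.prod (gaussianReal 0 σsq))) (w v : EuclideanSpace ℝ (Fin d)) :
    excessError e (gaussLaw PX σsq w) v = tildeExcess e PX σsq (v - w) := by
  simp only [excessError, expectedError_gaussLaw he_meas, tildeExcess]
  congr 1
  refine le_antisymm ?_ (le_ciInf fun u => tildeE_zero_le he he_meas he_symm hfin _)
  refine (ciInf_le ⟨tildeE e PX σsq 0, ?_⟩ w).trans_eq (by rw [sub_self])
  rintro _ ⟨u, rfl⟩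
  exact tildeE_zero_le he he_meas he_symm hfin _

end Excess

/-! ### The Bayes problem for a Gaussian prior -/

section Bayes

variable {E F G : Type*} [NormedAddCommGroup E] [InnerProductSpace ℝ E] [FiniteDimensional ℝ E]
  [MeasurableSpace E] [BorelSpace E] [NormedAddCommGroup F] [InnerProductSpace ℝ F]
  [FiniteDimensional ℝ F] [MeasurableSpace F] [BorelSpace F] [NormedAddCommGroup G]
  [InnerProductSpace ℝ G] [MeasurableSpace G] [BorelSpace G]

theorem charFun_map_prod_stdGaussian {L : E × F → G} (hL : Measurable L) {t : G} {a : E} {b : F}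
    (h : ∀ p, ⟪L p, t⟫_ℝ = ⟪p.1, a⟫_ℝ + ⟪p.2, b⟫_ℝ) :
    charFun (((stdGaussian E).prod (stdGaussian F)).map L) t =
      Complex.exp (-(‖a‖ ^ 2 + ‖b‖ ^ 2) / 2) := by
  have hc : Continuous fun x : ℝ => Complex.exp (x * Complex.I) := by fun_prop
  have hm : Measurable fun x : G => Complex.exp ((⟪x, t⟫_ℝ : ℝ) * Complex.I) :=
    hc.measurable.comp (Continuous.measurable (by fun_prop))
  rw [charFun_apply, integral_map hL.aemeasurable hm.aestronglyMeasurable]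
  simp only [h, Complex.ofReal_add, add_mul, Complex.exp_add]
  rw [integral_prod_mul (fun x : E => Complex.exp ((⟪x, a⟫_ℝ : ℝ) * Complex.I))
    (fun x : F => Complex.exp ((⟪x, b⟫_ℝ : ℝ) * Complex.I)), ← charFun_apply, ← charFun_apply,
    charFun_stdGaussian, charFun_stdGaussian, ← Complex.exp_add]
  congr 1
  ring

/-- If the parameter `(σ / s) w` and the noise `σ g` are Gaussian, then the posterior deviation of
the parameter of the linear model with design `A` from the ridge estimator does not depend on the
observations. Here `R` is the inverse of `A†A + s²`. -/
theorem indepFun_observation_ridgeError (A : E →L[ℝ] F) (R : E →L[ℝ] E) {σ s : ℝ} (hs : s ≠ 0)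
    (hR : ∀ v, A.adjoint (A (R v)) + s ^ 2 • R v = v) :
    IndepFun (fun p : E × F => A ((σ / s) • p.1) + σ • p.2)
      (fun p : E × F => σ • R (s • p.1 - A.adjoint p.2))
      ((stdGaussian E).prod (stdGaussian F)) := by
  -- `R` inherits self-adjointness from its inverse `A†A + s²`.
  have hRsymm : ∀ u v, ⟪R u, v⟫_ℝ = ⟪u, R v⟫_ℝ := by
    intro u v
    conv_lhs => rw [← hR v]
    conv_rhs => rw [← hR u]
    simp only [inner_add_left, inner_add_right, real_inner_smul_left, real_inner_smul_right,
      ContinuousLinearMap.adjoint_inner_left, ContinuousLinearMap.adjoint_inner_right]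
  rw [indepFun_iff_charFun_prod (by fun_prop) (by fun_prop)]
  intro t
  have h1 : ∀ q : E × F, ⟪A ((σ / s) • q.1) + σ • q.2, t.ofLp.1⟫_ℝ =
      ⟪q.1, (σ / s) • A.adjoint t.ofLp.1⟫_ℝ + ⟪q.2, σ • t.ofLp.1⟫_ℝ := by
    intro q
    simp only [inner_add_left, real_inner_smul_left, real_inner_smul_right, map_smul,
      ContinuousLinearMap.adjoint_inner_right]
  have h2 : ∀ q : E × F, ⟪σ • R (s • q.1 - A.adjoint q.2), t.ofLp.2⟫_ℝ =
      ⟪q.1, (σ * s) • R t.ofLp.2⟫_ℝ + ⟪q.2, (-σ) • A (R t.ofLp.2)⟫_ℝ := by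
    intro q
    simp only [real_inner_smul_left, real_inner_smul_right, hRsymm, inner_sub_left,
      ContinuousLinearMap.adjoint_inner_left]
    ring
  rw [charFun_map_prod_stdGaussian (by fun_prop) h1, charFun_map_prod_stdGaussian (by fun_prop) h2,
    charFun_map_prod_stdGaussian (a := (σ / s) • A.adjoint t.ofLp.1 + (σ * s) • R t.ofLp.2)
      (b := σ • t.ofLp.1 + (-σ) • A (R t.ofLp.2)) (by fun_prop), ← Complex.exp_add]
  -- The cross terms in the two squared norms cancel: `(σ/s)(σ s)⟪A†u, R v⟫ = σ²⟪u, A (R v)⟫`. This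
  -- vanishing covariance is the independence.
  · congr 1
    norm_cast
    rw [@norm_add_sq_real, @norm_add_sq_real]
    simp only [real_inner_smul_left, real_inner_smul_right,
      ContinuousLinearMap.adjoint_inner_left]
    field_simp
    ring
  · intro q
    rw [WithLp.prod_inner_apply]
    simp only [inner_add_right]
    rw [h1, h2]
    ring

/-- No estimator of a Gaussian parameter in the linear model is more likely to fall within a
symmetric convex neighbourhood of the parameter than the ridge estimator. -/
theorem measure_estimator_le (A : E →L[ℝ] F) (R : E →L[ℝ] E) {σ s : ℝ} (hs : s ≠ 0)
    (hR : ∀ v, A.adjoint (A (R v)) + s ^ 2 • R v = v) {f : F → E} (hf : Measurable f)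
    {K : Set E} (hK : MeasurableSet K) (hconv : Convex ℝ K) (hsymm : ∀ x ∈ K, -x ∈ K) :
    ((stdGaussian E).prod (stdGaussian F))
        {p | f (A ((σ / s) • p.1) + σ • p.2) - (σ / s) • p.1 ∈ K} ≤
      ((stdGaussian E).prod (stdGaussian F)) {p | σ • R (s • p.1 - A.adjoint p.2) ∈ K} := by
  -- In finite dimension the right inverse is also a left inverse.
  have hR' : ∀ v, R (A.adjoint (A v)) + s ^ 2 • R v = v := by
    have hinj : Function.Injective R := fun u v huv => by rw [← hR u, ← hR v, huv]
    have hsurj : Function.Surjective R := LinearMap.injective_iff_surjective.1 hinj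
    intro v
    obtain ⟨u, rfl⟩ := hsurj v
    rw [← map_smul, ← map_add, hR]
  set P := (stdGaussian E).prod (stdGaussian F)
  set y : E × F → F := fun p => A ((σ / s) • p.1) + σ • p.2 with hy
  set z : E × F → E := fun p => σ • R (s • p.1 - A.adjoint p.2) with hz
  have hym : Measurable y := by fun_prop
  have hzm : Measurable z := by fun_prop
  have hind := (indepFun_iff_map_prod_eq_prod_map_map hym.aemeasurable hzm.aemeasurable).1
    (indepFun_observation_ridgeError A R (σ := σ) hs hR)
  set h : F → E := fun v => R (A.adjoint v) - f v with hh
  have hhm : Measurable h := (by fun_prop : Measurable fun v => R (A.adjoint v)).sub hf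
  -- The parameter is the ridge estimate, a function of the observations, plus the independent
  -- deviation `z`.
  have hθ : ∀ p : E × F, (σ / s) • p.1 = R (A.adjoint (y p)) + z p := by
    intro p
    conv_lhs => rw [← hR' p.1]
    simp only [hy, hz, map_add, map_smul, map_sub, smul_add, smul_sub, smul_smul]
    have : σ / s * s ^ 2 = σ * s := by field_simp
    rw [this]
    abel
  have hset : {p : E × F | f (y p) - (σ / s) • p.1 ∈ K} =
      (fun p => (y p, z p)) ⁻¹' {q : F × E | h q.1 + q.2 ∈ K} := by
    ext p
    have : -(f (y p) - (σ / s) • p.1) = h (y p) + z p := by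
      rw [hθ p]; simp only [hh]; abel
    simp only [mem_ofPred_eq, mem_preimage, ← this]
    exact ⟨hsymm _, fun hp => by simpa using hsymm _ hp⟩
  have hmS : MeasurableSet {q : F × E | h q.1 + q.2 ∈ K} :=
    ((hhm.comp measurable_fst).add measurable_snd) hK
  have hPL : MidpointPL (P.map z) :=
    ((midpointPL_stdGaussian (E := E)).prod (midpointPL_stdGaussian (E := F))).map hzm
      fun p q => by
        simp only [hz, Prod.smul_fst, Prod.fst_add, Prod.smul_snd, Prod.snd_add, map_add, map_smul,
          map_sub, smul_add, smul_sub, smul_comm (1 / 2 : ℝ)]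
        abel
  have hnegP : P.map (fun p => -p) = P := by
    have := Measure.map_prod_map (stdGaussian E) (stdGaussian F) measurable_neg measurable_neg
    rw [map_neg_stdGaussian, map_neg_stdGaussian] at this
    exact this.symm
  have hneg : (P.map z).map (fun x => -x) = P.map z := by
    conv_rhs => rw [← hnegP]
    rw [Measure.map_map measurable_neg hzm, Measure.map_map hzm measurable_neg]
    congr 1
    funext p
    simp only [hz, Function.comp, Prod.fst_neg, Prod.snd_neg, map_sub, map_neg, map_smul, smul_neg,
      smul_sub]
    abel
  have : IsProbabilityMeasure (P.map y) := Measure.isProbabilityMeasure_map hym.aemeasurable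
  rw [hset, ← Measure.map_apply (hym.prodMk hzm) hmS, hind, Measure.prod_apply hmS]
  -- Given the observation `v`, the estimator merely shifts `z` by `h v`, so Anderson's inequality
  -- applies.
  calc ∫⁻ v, (P.map z) (Prod.mk v ⁻¹' {q : F × E | h q.1 + q.2 ∈ K}) ∂(P.map y)
      ≤ ∫⁻ _, (P.map z) K ∂(P.map y) :=
        lintegral_mono fun v => hPL.anderson hneg hK hconv hsymm (h v)
    _ = P {p | z p ∈ K} := by
        rw [lintegral_const, measure_univ, mul_one, Measure.map_apply hzm hK]; rfl

end Bayes

/-! ### Design and Gram operators, and the limit of vanishing regularization -/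

section Design

variable {d n : ℕ}

/-- The design operator `w ↦ (⟪xᵢ, w⟫)ᵢ` of the inputs `x`. -/
noncomputable def design (x : Fin n → EuclideanSpace ℝ (Fin d)) :
    EuclideanSpace ℝ (Fin d) →L[ℝ] EuclideanSpace ℝ (Fin n) :=
  ∑ i, (innerSL ℝ (x i)).smulRight (EuclideanSpace.single i (1 : ℝ))

theorem design_apply (x : Fin n → EuclideanSpace ℝ (Fin d)) (w : EuclideanSpace ℝ (Fin d))
    (i : Fin n) : design x w i = ⟪x i, w⟫_ℝ := by
  simp [design, Finset.sum_apply, Pi.single_apply]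

theorem adjoint_design_apply (x : Fin n → EuclideanSpace ℝ (Fin d))
    (g : EuclideanSpace ℝ (Fin n)) : (design x).adjoint g = ∑ i, g i • x i := by
  refine ext_inner_right ℝ fun v => ?_
  rw [ContinuousLinearMap.adjoint_inner_left, sum_inner, PiLp.inner_apply]
  refine Finset.sum_congr rfl fun i _ => ?_
  rw [design_apply, real_inner_smul_left]
  simp [mul_comm]

theorem continuous_design :
    Continuous (design : (Fin n → EuclideanSpace ℝ (Fin d)) → _) := by
  unfold design
  refine continuous_finsetSum _ fun i _ => ?_
  have h : Continuous fun x : Fin n → EuclideanSpace ℝ (Fin d) =>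
      ContinuousLinearMap.smulRightL ℝ (EuclideanSpace ℝ (Fin d)) (EuclideanSpace ℝ (Fin n))
        (innerSL ℝ (x i)) (EuclideanSpace.single i (1 : ℝ)) := by fun_prop
  exact h

theorem continuous_adjoint_design :
    Continuous fun x : Fin n → EuclideanSpace ℝ (Fin d) => (design x).adjoint :=
  (ContinuousLinearMap.adjoint (𝕜 := ℝ) (E := EuclideanSpace ℝ (Fin d))
    (F := EuclideanSpace ℝ (Fin n))).continuous.comp continuous_design

/-- The regularized Gram operator `A†A + r` of the design operator `A` of the inputs `x`. -/
noncomputable def gram (x : Fin n → EuclideanSpace ℝ (Fin d)) (r : ℝ) :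
    EuclideanSpace ℝ (Fin d) →L[ℝ] EuclideanSpace ℝ (Fin d) :=
  (design x).adjoint ∘L design x + r • 1

theorem gram_apply (x : Fin n → EuclideanSpace ℝ (Fin d)) (r : ℝ) (v : EuclideanSpace ℝ (Fin d)) :
    gram x r v = (design x).adjoint (design x v) + r • v := rfl

theorem continuous_gram (r : ℝ) :
    Continuous fun x : Fin n → EuclideanSpace ℝ (Fin d) => gram x r := by
  unfold gram
  exact (continuous_adjoint_design.clm_comp continuous_design).add continuous_const

theorem continuous_gram_right (x : Fin n → EuclideanSpace ℝ (Fin d)) : Continuous (gram x) := by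
  unfold gram
  exact continuous_const.add (continuous_id.smul continuous_const)

theorem continuousAt_inverse_gram {x : Fin n → EuclideanSpace ℝ (Fin d)} {r : ℝ}
    (hx : IsUnit (gram x r)) :
    ContinuousAt (fun x : Fin n → EuclideanSpace ℝ (Fin d) => Ring.inverse (gram x r)) x := by
  obtain ⟨u, hu⟩ := hx
  have hi := NormedRing.inverse_continuousAt u
  rw [hu] at hi
  exact Filter.Tendsto.comp hi (continuous_gram r).continuousAt

theorem tendsto_inverse_gram_zero {x : Fin n → EuclideanSpace ℝ (Fin d)}
    (hx : IsUnit (gram x 0)) :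
    Filter.Tendsto (fun r => Ring.inverse (gram x r)) (nhds 0)
      (nhds (Ring.inverse (gram x 0))) := by
  obtain ⟨u, hu⟩ := hx
  have hi := NormedRing.inverse_continuousAt u
  rw [hu] at hi
  exact Filter.Tendsto.comp hi (continuous_gram_right x).continuousAt

theorem isUnit_gram_iff (x : Fin n → EuclideanSpace ℝ (Fin d)) (r : ℝ) :
    IsUnit (gram x r) ↔ ∀ v, gram x r v = 0 → v = 0 := by
  rw [ContinuousLinearMap.isUnit_iff_bijective]
  constructor
  · intro h v hv
    exact h.1 (by rw [hv, map_zero])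
  · intro h
    have hinj : Function.Injective (gram x r) := (injective_iff_map_eq_zero _).2 h
    exact ⟨hinj, LinearMap.injective_iff_surjective.1 hinj⟩

theorem inner_gram_self (x : Fin n → EuclideanSpace ℝ (Fin d)) (r : ℝ)
    (v : EuclideanSpace ℝ (Fin d)) : ⟪gram x r v, v⟫_ℝ = ‖design x v‖ ^ 2 + r * ‖v‖ ^ 2 := by
  rw [gram_apply, inner_add_left, ContinuousLinearMap.adjoint_inner_left, real_inner_smul_left,
    real_inner_self_eq_norm_sq, real_inner_self_eq_norm_sq]

theorem isUnit_gram_of_pos (x : Fin n → EuclideanSpace ℝ (Fin d)) {r : ℝ} (hr : 0 < r) :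
    IsUnit (gram x r) := by
  rw [isUnit_gram_iff]
  intro v hv
  have h := inner_gram_self x r v
  rw [hv, inner_zero_left] at h
  have h2 : r * ‖v‖ ^ 2 = 0 := by nlinarith [sq_nonneg ‖design x v‖, mul_nonneg hr.le (sq_nonneg ‖v‖)]
  simpa [hr.ne'] using h2

theorem design_eq_zero_of_gram_eq_zero {x : Fin n → EuclideanSpace ℝ (Fin d)}
    {v : EuclideanSpace ℝ (Fin d)} (hv : gram x 0 v = 0) : design x v = 0 := by
  have h := inner_gram_self x 0 v
  rw [hv, inner_zero_left, zero_mul, add_zero] at h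
  simpa using h.symm

theorem gram_zero_apply_ofLp (hn : 0 < n) (x : Fin n → EuclideanSpace ℝ (Fin d))
    (v : EuclideanSpace ℝ (Fin d)) :
    (gram x 0 v).ofLp = (n : ℝ) • (sampleCov x).mulVec v.ofLp := by
  have hn' : (n : ℝ) ≠ 0 := by positivity
  ext j
  rw [gram_apply, adjoint_design_apply]
  simp only [design_apply, zero_smul, add_zero, WithLp.ofLp_sum, WithLp.ofLp_smul,
    Finset.sum_apply, Pi.smul_apply, smul_eq_mul, Matrix.mulVec, dotProduct, sampleCov_apply,
    PiLp.inner_apply, Finset.mul_sum, Finset.sum_mul]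
  rw [Finset.sum_comm]
  refine Finset.sum_congr rfl fun k _ => Finset.sum_congr rfl fun i _ => ?_
  simp only [RCLike.inner_apply, conj_trivial]
  field_simp

theorem isUnit_sampleCov_iff (hn : 0 < n) (x : Fin n → EuclideanSpace ℝ (Fin d)) :
    IsUnit (sampleCov x) ↔ IsUnit (gram x 0) := by
  have hn' : (n : ℝ) ≠ 0 := by positivity
  rw [isUnit_gram_iff, ← Matrix.mulVec_injective_iff_isUnit]
  have h0 : ∀ v : EuclideanSpace ℝ (Fin d), gram x 0 v = 0 ↔ (sampleCov x).mulVec v.ofLp = 0 := by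
    intro v
    rw [← (WithLp.ofLp_injective 2).eq_iff, gram_zero_apply_ofLp hn, WithLp.ofLp_zero,
      smul_eq_zero_iff_right hn']
  constructor
  · intro h v hv
    have := h (((h0 v).1 hv).trans (Matrix.mulVec_zero _).symm)
    exact WithLp.ofLp_injective 2 this
  · intro h u v huv
    have h1 := h (WithLp.toLp 2 (u - v)) ((h0 _).2 (by
      simp only [Matrix.mulVec_sub]; exact sub_eq_zero.2 huv))
    have h2 := congrArg WithLp.ofLp h1
    simpa [sub_eq_zero] using h2

theorem measurableSet_isUnit_sampleCov (hn : 0 < n) :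
    MeasurableSet {x : Fin n → EuclideanSpace ℝ (Fin d) | IsUnit (sampleCov x)} := by
  simp only [isUnit_sampleCov_iff hn]
  exact (Units.isOpen.preimage (continuous_gram 0)).measurableSet

theorem inverse_gram_spec (x : Fin n → EuclideanSpace ℝ (Fin d)) {r : ℝ} (hr : IsUnit (gram x r))
    (v : EuclideanSpace ℝ (Fin d)) : gram x r (Ring.inverse (gram x r) v) = v := by
  have := Ring.mul_inverse_cancel _ hr
  exact congrArg (fun T : EuclideanSpace ℝ (Fin d) →L[ℝ] EuclideanSpace ℝ (Fin d) => T v) this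

theorem eq_of_gram_eq {x : Fin n → EuclideanSpace ℝ (Fin d)} {r : ℝ} (hr : IsUnit (gram x r))
    {u v : EuclideanSpace ℝ (Fin d)} (h : gram x r u = gram x r v) : u = v :=
  ((ContinuousLinearMap.isUnit_iff_bijective).1 hr).1 h

/-- The error of the least squares estimator for the noise vector `√σsq • g`. -/
noncomputable def olsError (σsq : ℝ≥0) (x : Fin n → EuclideanSpace ℝ (Fin d))
    (g : EuclideanSpace ℝ (Fin n)) : EuclideanSpace ℝ (Fin d) :=
  Ring.inverse (gram x 0) (Real.sqrt σsq • (design x).adjoint g)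

/-- Both laws are linear images of the same standard Gaussian, and the two maps agree after applying
the injective `gram x 0`, which is `n` times the sample covariance. -/
theorem condLaw_eq_map_olsError (hn : 0 < n) (σsq : ℝ≥0) {x : Fin n → EuclideanSpace ℝ (Fin d)}
    (hx : IsUnit (sampleCov x)) :
    condLaw σsq x = (stdGaussian (EuclideanSpace ℝ (Fin n))).map (olsError σsq x) := by
  have hn' : (n : ℝ) ≠ 0 := by positivity
  have hg := (isUnit_sampleCov_iff hn x).1 hx
  rw [condLaw, if_pos hx, multivariateGaussian_eq_map _ (by positivity) x hx]
  congr 1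
  funext g
  refine eq_of_gram_eq hg ?_
  rw [olsError, inverse_gram_spec x hg]
  refine WithLp.ofLp_injective 2 ?_
  have hsq : √((σsq : ℝ) / n * (n : ℝ)⁻¹) = √σsq * (n : ℝ)⁻¹ := by
    rw [div_eq_mul_inv, mul_assoc, ← sq, Real.sqrt_mul (by positivity),
      Real.sqrt_sq (by positivity)]
  rw [gram_zero_apply_ofLp hn, Matrix.smul_mulVec, Matrix.mulVec_smul, Matrix.mulVec_mulVec,
    ← Matrix.mul_assoc, Matrix.mul_nonsing_inv _ ((Matrix.isUnit_iff_isUnit_det _).1 hx),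
    Matrix.one_mul, hsq, adjoint_design_apply, smul_smul]
  have : (n : ℝ) * (√σsq * (n : ℝ)⁻¹) = √σsq := by field_simp
  rw [this]
  ext j
  simp [Matrix.mulVec, dotProduct, mul_comm]

/-- The error of the ridge estimator for the Gaussian parameter `(σ / s) w` and noise `σ g`. -/
noncomputable def ridgeError (σ s : ℝ) (q : (Fin n → EuclideanSpace ℝ (Fin d)) ×
    EuclideanSpace ℝ (Fin d) × EuclideanSpace ℝ (Fin n)) : EuclideanSpace ℝ (Fin d) :=
  σ • Ring.inverse (gram q.1 (s ^ 2)) (s • q.2.1 - (design q.1).adjoint q.2.2)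

theorem gram_ridgeError (σ : ℝ) {s : ℝ} (hs : s ≠ 0) (q : (Fin n → EuclideanSpace ℝ (Fin d)) ×
    EuclideanSpace ℝ (Fin d) × EuclideanSpace ℝ (Fin n)) :
    gram q.1 (s ^ 2) (ridgeError σ s q) = σ • (s • q.2.1 - (design q.1).adjoint q.2.2) := by
  rw [ridgeError, map_smul, inverse_gram_spec _ (isUnit_gram_of_pos _ (by positivity))]

theorem continuous_ridgeError (σ : ℝ) {s : ℝ} (hs : s ≠ 0) :
    Continuous (ridgeError (d := d) (n := n) σ s) := by
  have h0 : Continuous fun x : Fin n → EuclideanSpace ℝ (Fin d) => Ring.inverse (gram x (s ^ 2)) :=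
    continuous_iff_continuousAt.2 fun x =>
      continuousAt_inverse_gram (isUnit_gram_of_pos x (by positivity))
  have h1 := h0.comp (continuous_fst (Y := EuclideanSpace ℝ (Fin d) × EuclideanSpace ℝ (Fin n)))
  have h2 := (continuous_adjoint_design (d := d) (n := n)).comp
    (continuous_fst (Y := EuclideanSpace ℝ (Fin d) × EuclideanSpace ℝ (Fin n)))
  unfold ridgeError
  refine (h1.clm_apply (Continuous.sub (by fun_prop) (h2.clm_apply (by fun_prop)))).const_smul σ

/-- The prior term `s • w` vanishes and inversion is continuous at units. The sign appears because
the ridge error is parameter minus estimate, while `olsError` is estimate minus parameter. -/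
theorem tendsto_ridgeError (σsq : ℝ≥0) {x : Fin n → EuclideanSpace ℝ (Fin d)}
    (hx : IsUnit (gram x 0)) (w : EuclideanSpace ℝ (Fin d)) (g : EuclideanSpace ℝ (Fin n)) :
    Filter.Tendsto (fun s => ridgeError (Real.sqrt σsq) s (x, w, g)) (nhds 0)
      (nhds (-olsError σsq x g)) := by
  have h1 : Filter.Tendsto (fun s : ℝ => Ring.inverse (gram x (s ^ 2))) (nhds 0)
      (nhds (Ring.inverse (gram x 0))) :=
    (tendsto_inverse_gram_zero hx).comp
      (by simpa using (by fun_prop : Continuous fun s : ℝ => s ^ 2).tendsto 0)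
  have h2 : Filter.Tendsto (fun s : ℝ => s • w - (design x).adjoint g) (nhds 0)
      (nhds ((0 : ℝ) • w - (design x).adjoint g)) := Continuous.tendsto (by fun_prop) 0
  have h3 := (((isBoundedBilinearMap_apply (𝕜 := ℝ) (E := EuclideanSpace ℝ (Fin d))
    (F := EuclideanSpace ℝ (Fin d))).continuous.tendsto
      (_, _)).comp (h1.prodMk_nhds h2)).const_smul (Real.sqrt σsq)
  simpa [ridgeError, olsError, Function.comp_def] using h3

/-- The data carry no information along a kernel direction of the design: there the deviation is
that of the prior, of order `1/s`. -/
theorem inner_ridgeError_of_design_eq_zero (σ : ℝ) {s : ℝ} (hs : s ≠ 0)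
    {x : Fin n → EuclideanSpace ℝ (Fin d)} {v : EuclideanSpace ℝ (Fin d)} (hv : design x v = 0)
    (w : EuclideanSpace ℝ (Fin d)) (g : EuclideanSpace ℝ (Fin n)) :
    s * ⟪ridgeError σ s (x, w, g), v⟫_ℝ = σ * ⟪w, v⟫_ℝ := by
  have h := congrArg (fun u => ⟪u, v⟫_ℝ) (gram_ridgeError σ hs (x, w, g))
  simp only [gram_apply, inner_add_left, real_inner_smul_left, inner_sub_left,
    ContinuousLinearMap.adjoint_inner_left, hv, inner_zero_right, zero_add, sub_zero] at h
  refine mul_left_cancel₀ hs ?_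
  linear_combination h

theorem stdGaussian_inner_eq_zero {v : EuclideanSpace ℝ (Fin d)} (hv : v ≠ 0) :
    stdGaussian (EuclideanSpace ℝ (Fin d)) {w | ⟪w, v⟫_ℝ = 0} = 0 := by
  have hmap := IsGaussian.map_eq_gaussianReal (μ := stdGaussian (EuclideanSpace ℝ (Fin d)))
    (innerSL ℝ v)
  have hset : {w : EuclideanSpace ℝ (Fin d) | ⟪w, v⟫_ℝ = 0} = innerSL ℝ v ⁻¹' {0} := by
    ext w; simp [real_inner_comm]
  have hvar : Var[innerSL ℝ v; stdGaussian (EuclideanSpace ℝ (Fin d))].toNNReal ≠ 0 := by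
    rw [variance_dual_stdGaussian, innerSL_apply_norm]
    simpa using hv
  have := nullSingletonClass_gaussianReal (μ := (stdGaussian (EuclideanSpace ℝ (Fin d)))[innerSL ℝ v]) hvar
  rw [hset, ← Measure.map_apply (by fun_prop) (measurableSet_singleton 0), hmap]
  exact measure_singleton 0

theorem measurable_olsError (σsq : ℝ≥0) (x : Fin n → EuclideanSpace ℝ (Fin d)) :
    Measurable (olsError σsq x) := by
  unfold olsError; fun_prop

open Classical in
/-- As the regularization vanishes, the events that the ridge error lies in a compact set `K` have
upper limit of measure at most that of the event that the least squares error lies in `K`. -/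
theorem measure_limsup_ridgeError_le (hn : 0 < n) {σsq : ℝ≥0} (hσ : 0 < σsq)
    {K : Set (EuclideanSpace ℝ (Fin d))} (hK : IsCompact K) (hsymm : ∀ v ∈ K, -v ∈ K) {s : ℕ → ℝ}
    (hs : ∀ k, s k ≠ 0) (hlim : Filter.Tendsto s Filter.atTop (nhds 0))
    (x : Fin n → EuclideanSpace ℝ (Fin d)) :
    ((stdGaussian (EuclideanSpace ℝ (Fin d))).prod (stdGaussian (EuclideanSpace ℝ (Fin n))))
      {p | ∃ᶠ k in Filter.atTop, ridgeError (Real.sqrt σsq) (s k) (x, p) ∈ K} ≤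
      if IsUnit (sampleCov x) then condLaw σsq x K else 0 := by
  split_ifs with hx
  · have hg := (isUnit_sampleCov_iff hn x).1 hx
    rw [condLaw_eq_map_olsError hn σsq hx,
      Measure.map_apply (measurable_olsError σsq x) hK.measurableSet]
    have hsub : {p : EuclideanSpace ℝ (Fin d) × EuclideanSpace ℝ (Fin n) |
        ∃ᶠ k in Filter.atTop, ridgeError (Real.sqrt σsq) (s k) (x, p) ∈ K} ⊆
        univ ×ˢ (olsError σsq x ⁻¹' K) := by
      rintro ⟨w, g⟩ hp
      refine ⟨mem_univ _, ?_⟩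
      have := hK.isClosed.mem_of_frequently_of_tendsto hp
        ((tendsto_ridgeError σsq hg w g).comp hlim)
      simpa using hsymm _ this
    refine (measure_mono hsub).trans_eq ?_
    rw [Measure.prod_prod, measure_univ, one_mul]
  · rw [isUnit_sampleCov_iff hn, isUnit_gram_iff] at hx
    push Not at hx
    obtain ⟨v, hv, hv0⟩ := hx
    have hAv := design_eq_zero_of_gram_eq_zero hv
    have hsub : {p : EuclideanSpace ℝ (Fin d) × EuclideanSpace ℝ (Fin n) |
        ∃ᶠ k in Filter.atTop, ridgeError (Real.sqrt σsq) (s k) (x, p) ∈ K} ⊆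
        {w | ⟪w, v⟫_ℝ = 0} ×ˢ univ := by
      rintro ⟨w, g⟩ hp
      refine ⟨?_, mem_univ _⟩
      obtain ⟨C, hC⟩ := hK.isBounded.exists_norm_le
      -- The bound holds at `r = s k` whenever the ridge error lies in `K`; letting `s k → 0` forces
      -- `⟪w, v⟫ = 0`, a null event.
      have hcl : IsClosed {r : ℝ | |Real.sqrt σsq * ⟪w, v⟫_ℝ| ≤ |r| * (C * ‖v‖)} :=
        isClosed_le continuous_const (by fun_prop)
      have := hcl.mem_of_frequently_of_tendsto (hp.mono fun k hk => by
        rw [mem_ofPred_eq, ← inner_ridgeError_of_design_eq_zero _ (hs k) hAv w g, abs_mul]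
        gcongr
        exact (abs_real_inner_le_norm _ _).trans (by gcongr; exact hC _ hk)) hlim
      simp only [mem_ofPred_eq, abs_zero, zero_mul, abs_nonpos_iff, mul_eq_zero] at this
      exact this.resolve_left (by positivity)
    refine (measure_mono hsub).trans_eq ?_
    rw [Measure.prod_prod, stdGaussian_inner_eq_zero hv0, zero_mul]

end Design

/-! ### Upper limits of events -/

theorem setOf_frequently_eq {α : Type*} (S : ℕ → Set α) :
    {a | ∃ᶠ k in Filter.atTop, a ∈ S k} = ⋂ m : ℕ, ⋃ k ≥ m, S k := by
  ext a
  simp [Filter.frequently_atTop]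

theorem measurableSet_setOf_frequently {α : Type*} [MeasurableSpace α] {S : ℕ → Set α}
    (hS : ∀ k, MeasurableSet (S k)) : MeasurableSet {a | ∃ᶠ k in Filter.atTop, a ∈ S k} := by
  rw [setOf_frequently_eq]
  exact MeasurableSet.iInter fun m =>
    MeasurableSet.iUnion fun k => MeasurableSet.iUnion fun _ => hS k

/-- Reverse Fatou for sets: the tail unions decrease to the upper limit and each has measure at
least `c`. -/
theorem le_measure_setOf_frequently {α : Type*} [MeasurableSpace α] {μ : Measure α}
    [IsFiniteMeasure μ] {S : ℕ → Set α} (hS : ∀ k, MeasurableSet (S k)) {c : ℝ≥0∞}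
    (hc : ∀ k, c ≤ μ (S k)) : c ≤ μ {a | ∃ᶠ k in Filter.atTop, a ∈ S k} := by
  have hanti : Antitone fun m : ℕ => ⋃ k ≥ m, S k := fun m m' hm =>
    biUnion_subset_biUnion_left fun k hk => le_trans hm hk
  rw [setOf_frequently_eq, hanti.measure_iInter (fun m => (MeasurableSet.iUnion fun k =>
    MeasurableSet.iUnion fun _ => hS k).nullMeasurableSet) ⟨0, measure_ne_top _ _⟩]
  exact le_iInf fun m => (hc m).trans (measure_mono (subset_biUnion_of_mem (u := S) (le_refl m)))

/-! ### Laws of the data and of the limiting loss -/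

variable {d n : ℕ} {PX : Measure (EuclideanSpace ℝ (Fin d))} [IsProbabilityMeasure PX]
  {σsq : ℝ≥0} {e : ℝ → ℝ}

/-- The data set with inputs `x` and outputs `y`. -/
def dataset (x : Fin n → EuclideanSpace ℝ (Fin d)) (y : EuclideanSpace ℝ (Fin n)) :
    Fin n → EuclideanSpace ℝ (Fin d) × ℝ :=
  fun i => (x i, y i)

theorem measurable_dataset : Measurable fun q : (Fin n → EuclideanSpace ℝ (Fin d)) ×
    EuclideanSpace ℝ (Fin n) => dataset q.1 q.2 := by
  unfold dataset
  fun_prop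

theorem continuous_design_apply : Continuous fun q : (Fin n → EuclideanSpace ℝ (Fin d)) ×
    EuclideanSpace ℝ (Fin d) => design q.1 q.2 :=
  (continuous_design.comp continuous_fst).clm_apply continuous_snd

theorem measurable_dataset_design (σ : ℝ) (w : EuclideanSpace ℝ (Fin d)) :
    Measurable fun q : (Fin n → EuclideanSpace ℝ (Fin d)) × EuclideanSpace ℝ (Fin n) =>
      dataset q.1 (design q.1 w + σ • q.2) := by
  have h : Continuous fun q : (Fin n → EuclideanSpace ℝ (Fin d)) × EuclideanSpace ℝ (Fin n) =>
      design q.1 w + σ • q.2 :=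
    (continuous_design_apply.comp (by fun_prop : Continuous fun q :
      (Fin n → EuclideanSpace ℝ (Fin d)) × EuclideanSpace ℝ (Fin n) => (q.1, w))).add (by fun_prop)
  exact measurable_dataset.comp (measurable_fst.prodMk h.measurable)

theorem gaussianReal_eq_map_std (σsq : ℝ≥0) :
    gaussianReal 0 σsq = (gaussianReal 0 1).map (fun g => Real.sqrt σsq * g) := by
  rw [gaussianReal_map_const_mul]
  congr 1
  · simp
  · ext; simp

/-- Regrouping the i.i.d. pairs separates the inputs from the noise vector, so that one can argue
conditionally on the design. -/
theorem pi_gaussLaw_eq_map (w : EuclideanSpace ℝ (Fin d)) :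
    Measure.pi (fun _ : Fin n => gaussLaw PX σsq w) =
      ((Measure.pi fun _ : Fin n => PX).prod (stdGaussian (EuclideanSpace ℝ (Fin n)))).map
        (fun q => dataset q.1 (design q.1 w + Real.sqrt σsq • q.2)) := by
  set f : EuclideanSpace ℝ (Fin d) × ℝ → EuclideanSpace ℝ (Fin d) × ℝ :=
    fun q => (q.1, ⟪w, q.1⟫_ℝ + Real.sqrt σsq * q.2) with hf
  have hfm : Measurable f := by fun_prop
  have h1 : gaussLaw PX σsq w = (PX.prod (gaussianReal 0 1)).map f := by
    have := Measure.map_prod_map PX (gaussianReal 0 1) measurable_id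
      (by fun_prop : Measurable fun g : ℝ => Real.sqrt σsq * g)
    rw [Measure.map_id, ← gaussianReal_eq_map_std] at this
    rw [gaussLaw, this, Measure.map_map (by fun_prop) (by fun_prop)]
    rfl
  have hprob : IsProbabilityMeasure ((PX.prod (gaussianReal 0 1)).map f) :=
    Measure.isProbabilityMeasure_map hfm.aemeasurable
  have h2 := (measurePreserving_arrowProdEquivProdArrow (EuclideanSpace ℝ (Fin d)) ℝ (Fin n)
    (fun _ => PX) (fun _ => gaussianReal 0 1)).symm.map_eq
  have h3 := Measure.map_prod_map (Measure.pi fun _ : Fin n => PX)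
    (stdGaussian (EuclideanSpace ℝ (Fin n))) measurable_id
    (by fun_prop : Measurable fun g : EuclideanSpace ℝ (Fin n) => g.ofLp)
  have h4 : (stdGaussian (EuclideanSpace ℝ (Fin n))).map (fun g => g.ofLp) =
      Measure.pi fun _ : Fin n => gaussianReal 0 1 := by
    rw [← map_pi_eq_stdGaussian, Measure.map_map (by fun_prop) (by fun_prop)]
    exact Measure.map_id
  rw [Measure.map_id, h4] at h3
  simp only [h1]
  rw [← Measure.pi_map_pi (fun _ => hfm.aemeasurable), ← h2, h3,
    Measure.map_map (by fun_prop) (by fun_prop), Measure.map_map (by fun_prop) (by fun_prop)]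
  congr 1
  funext q
  ext i : 1
  simp [dataset, hf, design_apply, real_inner_comm, MeasurableEquiv.arrowProdEquivProdArrow,
    Equiv.arrowProdEquivProdArrow]

/-- Probability that a procedure has excess error at most `t`, in terms of the noise vector. -/
theorem pi_gaussLaw_excessError_le (he : ConvexOn ℝ univ e) (he_meas : Measurable e)
    (he_symm : ∀ t, e (-t) = e t)
    (hfin : ∀ Δ : EuclideanSpace ℝ (Fin d),
      Integrable (fun q : EuclideanSpace ℝ (Fin d) × ℝ => e (⟪Δ, q.1⟫_ℝ + q.2))
        (PX.prod (gaussianReal 0 σsq)))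
    {what : (Fin n → EuclideanSpace ℝ (Fin d) × ℝ) → EuclideanSpace ℝ (Fin d)}
    (hwhat : Measurable what) (w : EuclideanSpace ℝ (Fin d)) (t : ℝ≥0) :
    Measure.pi (fun _ : Fin n => gaussLaw PX σsq w)
        {D | ENNReal.ofReal (excessError e (gaussLaw PX σsq w) (what D)) ≤ t} =
      ((Measure.pi fun _ : Fin n => PX).prod (stdGaussian (EuclideanSpace ℝ (Fin n))))
        {q | what (dataset q.1 (design q.1 w + Real.sqrt σsq • q.2)) - w ∈
          {Δ | tildeExcess e PX σsq Δ ≤ t}} := by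
  have hcont := continuous_tildeExcess he hfin
  have hset : {D | ENNReal.ofReal (excessError e (gaussLaw PX σsq w) (what D)) ≤ t} =
      {D : Fin n → EuclideanSpace ℝ (Fin d) × ℝ | tildeExcess e PX σsq (what D - w) ≤ t} := by
    ext D
    simp only [mem_ofPred_eq, excessError_gaussLaw he he_meas he_symm hfin]
    rw [ENNReal.ofReal_le_iff_le_toReal ENNReal.coe_ne_top, ENNReal.coe_toReal]
  have hmeas : MeasurableSet {D : Fin n → EuclideanSpace ℝ (Fin d) × ℝ |
      tildeExcess e PX σsq (what D - w) ≤ t} :=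
    (hcont.measurable.comp (hwhat.sub_const w)) measurableSet_Iic
  rw [hset, pi_gaussLaw_eq_map, Measure.map_apply (measurable_dataset_design _ w) hmeas]
  rfl

open Classical in
-- As `t` is finite, singular designs contribute nothing.
theorem jointLaw_limitLoss_le (hn : 0 < n) (he : ConvexOn ℝ univ e)
    (hfin : ∀ Δ : EuclideanSpace ℝ (Fin d),
      Integrable (fun q : EuclideanSpace ℝ (Fin d) × ℝ => e (⟪Δ, q.1⟫_ℝ + q.2))
        (PX.prod (gaussianReal 0 σsq))) (t : ℝ≥0) :
    jointLaw n PX σsq {q | limitLoss n e PX σsq q ≤ t} =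
      ∫⁻ x, (if IsUnit (sampleCov x) then condLaw σsq x {Δ | tildeExcess e PX σsq Δ ≤ t} else 0)
        ∂(Measure.pi fun _ : Fin n => PX) := by
  have hK : MeasurableSet {Δ | tildeExcess e PX σsq Δ ≤ t} :=
    (isClosed_le (continuous_tildeExcess he hfin) continuous_const).measurableSet
  have hset : {q | limitLoss n e PX σsq q ≤ t} =
      {x | IsUnit (sampleCov x)} ×ˢ {Δ | tildeExcess e PX σsq Δ ≤ t} := by
    ext q
    simp only [limitLoss, mem_ofPred_eq, mem_prod]
    split_ifs with h
    · rw [ENNReal.ofReal_le_iff_le_toReal ENNReal.coe_ne_top, ENNReal.coe_toReal]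
      simp [h]
    · simp [h]
  rw [hset, jointLaw, Measure.compProd_apply_prod (measurableSet_isUnit_sampleCov hn) hK,
    ← lintegral_indicator (measurableSet_isUnit_sampleCov hn)]
  rfl

/-! ### Lower bound by increasingly flat Gaussian priors -/

theorem lintegral_measure_slice_swap {α β γ : Type*} [MeasurableSpace α] [MeasurableSpace β]
    [MeasurableSpace γ] {μ : Measure α} {ν : Measure β} {ρ : Measure γ} [SFinite μ] [SFinite ν]
    [SFinite ρ] {S : Set (β × α × γ)} (hS : MeasurableSet S) :
    ∫⁻ a, (ν.prod ρ) {q | (q.1, a, q.2) ∈ S} ∂μ = ∫⁻ b, (μ.prod ρ) {p | (b, p) ∈ S} ∂ν := by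
  have hm : Measurable fun p : β × α => ρ {c | (p.1, p.2, c) ∈ S} := by
    have hT : MeasurableSet {p : (β × α) × γ | (p.1.1, p.1.2, p.2) ∈ S} :=
      (by fun_prop : Measurable fun p : (β × α) × γ => (p.1.1, p.1.2, p.2)) hS
    exact measurable_measure_prodMk_left hT
  calc ∫⁻ a, (ν.prod ρ) {q | (q.1, a, q.2) ∈ S} ∂μ
      = ∫⁻ a, ∫⁻ b, ρ {c | (b, a, c) ∈ S} ∂ν ∂μ := by
        refine lintegral_congr fun a => ?_
        exact Measure.prod_apply ((by fun_prop : Measurable fun q : β × γ => (q.1, a, q.2)) hS)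
    _ = ∫⁻ b, ∫⁻ a, ρ {c | (b, a, c) ∈ S} ∂μ ∂ν :=
        lintegral_lintegral_swap (hm.comp measurable_swap).aemeasurable
    _ = ∫⁻ b, (μ.prod ρ) {p | (b, p) ∈ S} ∂ν := by
        refine lintegral_congr fun b => ?_
        exact (Measure.prod_apply (measurable_prodMk_left hS)).symm

/-- If a procedure has excess error at most `t` with probability at least `c` whatever the
regression vector, then so does the limiting Gaussian deviation. -/
theorem le_jointLaw_of_forall_le (hn : 0 < n) (hσ : 0 < σsq) (he : StrictConvexOn ℝ univ e)
    (he_meas : Measurable e) (he_symm : ∀ t, e (-t) = e t)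
    (hPX : ∀ w : EuclideanSpace ℝ (Fin d), w ≠ 0 → ¬ PX.support ⊆ {x | ⟪w, x⟫_ℝ = 0})
    (hfin : ∀ Δ : EuclideanSpace ℝ (Fin d),
      Integrable (fun q : EuclideanSpace ℝ (Fin d) × ℝ => e (⟪Δ, q.1⟫_ℝ + q.2))
        (PX.prod (gaussianReal 0 σsq)))
    {what : (Fin n → EuclideanSpace ℝ (Fin d) × ℝ) → EuclideanSpace ℝ (Fin d)}
    (hwhat : Measurable what) {t : ℝ≥0} {c : ℝ≥0∞}
    (hc : ∀ w, c ≤ Measure.pi (fun _ : Fin n => gaussLaw PX σsq w)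
        {D | ENNReal.ofReal (excessError e (gaussLaw PX σsq w) (what D)) ≤ t}) :
    c ≤ jointLaw n PX σsq {q | limitLoss n e PX σsq q ≤ t} := by
  set K := {Δ | tildeExcess e PX σsq Δ ≤ t} with hKdef
  have hKc : IsCompact K := isCompact_tildeExcess_le he he_meas he_symm hPX hfin t
  have hKs : ∀ v ∈ K, -v ∈ K := fun v hv => by
    simpa only [hKdef, mem_ofPred_eq, tildeExcess_neg he_meas he_symm] using hv
  have hKconv : Convex ℝ K := convex_tildeExcess_le he.convexOn hfin t
  set μ := Measure.pi fun _ : Fin n => PX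
  set γd := stdGaussian (EuclideanSpace ℝ (Fin d))
  set γn := stdGaussian (EuclideanSpace ℝ (Fin n))
  set σ := Real.sqrt σsq
  simp only [pi_gaussLaw_excessError_le he.convexOn he_meas he_symm hfin hwhat] at hc
  -- The bound `c` holds for every `w`, hence on average over the prior `(σ/s) w` with `w` standard
  -- Gaussian. Tonelli then fixes the inputs first, and the Bayes bound applies to each design.
  have hridge : ∀ s : ℝ, s ≠ 0 → c ≤ (μ.prod (γd.prod γn)) {q | ridgeError σ s q ∈ K} := by
    intro s hs
    set S : Set ((Fin n → EuclideanSpace ℝ (Fin d)) × EuclideanSpace ℝ (Fin d) ×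
        EuclideanSpace ℝ (Fin n)) :=
      {q | what (dataset q.1 (design q.1 ((σ / s) • q.2.1) + σ • q.2.2)) - (σ / s) • q.2.1 ∈ K}
      with hS
    have hSm : MeasurableSet S := by
      have h1 : Continuous fun q : (Fin n → EuclideanSpace ℝ (Fin d)) × EuclideanSpace ℝ (Fin d) ×
          EuclideanSpace ℝ (Fin n) => design q.1 ((σ / s) • q.2.1) + σ • q.2.2 :=
        (continuous_design_apply.comp (by fun_prop : Continuous fun q :
          (Fin n → EuclideanSpace ℝ (Fin d)) × EuclideanSpace ℝ (Fin d) ×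
          EuclideanSpace ℝ (Fin n) => (q.1, (σ / s) • q.2.1))).add (by fun_prop)
      exact ((hwhat.comp (measurable_dataset.comp (measurable_fst.prodMk h1.measurable))).sub
        (by fun_prop)) hKc.measurableSet
    calc c = ∫⁻ _, c ∂γd := by simp
      _ ≤ ∫⁻ w, (μ.prod γn) {q | (q.1, w, q.2) ∈ S} ∂γd :=
          lintegral_mono fun w => hc ((σ / s) • w)
      _ = ∫⁻ x, (γd.prod γn) {p | (x, p) ∈ S} ∂μ := lintegral_measure_slice_swap hSm
      _ ≤ ∫⁻ x, (γd.prod γn) {p | ridgeError σ s (x, p) ∈ K} ∂μ := by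
          refine lintegral_mono fun x => ?_
          have hf : Measurable fun y => what (dataset x y) :=
            hwhat.comp (measurable_dataset.comp measurable_prodMk_left)
          exact measure_estimator_le (design x) (Ring.inverse (gram x (s ^ 2))) hs
            (fun v => inverse_gram_spec x (isUnit_gram_of_pos x (by positivity)) v) hf
            hKc.measurableSet hKconv hKs
      _ = (μ.prod (γd.prod γn)) {q | ridgeError σ s q ∈ K} :=
          (Measure.prod_apply
            ((continuous_ridgeError σ hs).measurable hKc.measurableSet)).symm
  have hs : ∀ k : ℕ, (1 / ((k : ℝ) + 1)) ≠ 0 := fun k => by positivity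
  have hSm : ∀ k : ℕ, MeasurableSet
      {q : (Fin n → EuclideanSpace ℝ (Fin d)) × EuclideanSpace ℝ (Fin d) ×
        EuclideanSpace ℝ (Fin n) | ridgeError σ (1 / ((k : ℝ) + 1)) q ∈ K} := fun k =>
    (continuous_ridgeError σ (hs k)).measurable hKc.measurableSet
  -- The upper limit is taken along `s = 1/(k + 1)`, then bounded design by design.
  refine (le_measure_setOf_frequently hSm fun k => hridge _ (hs k)).trans ?_
  rw [Measure.prod_apply (measurableSet_setOf_frequently hSm), jointLaw_limitLoss_le hn he.convexOn hfin]
  exact lintegral_mono fun x => measure_limsup_ridgeError_le hn hσ hKc hKs hs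
    tendsto_one_div_add_atTop_nhds_zero_nat x

/-! ### Least squares attains the bound -/

/-- The normal equations hold for `what` whenever the sample covariance matrix is invertible. -/
def SolvesNormalEquations
    (what : (Fin n → EuclideanSpace ℝ (Fin d) × ℝ) → EuclideanSpace ℝ (Fin d)) : Prop :=
  ∀ x y, IsUnit (sampleCov x) →
    gram x 0 (what (dataset x y)) = (design x).adjoint y

theorem IsLeastSquares.solvesNormalEquations (hn : 0 < n)
    {what : (Fin n → EuclideanSpace ℝ (Fin d) × ℝ) → EuclideanSpace ℝ (Fin d)}
    (h : IsLeastSquares what) : SolvesNormalEquations what := by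
  intro x y _
  set w := what (dataset x y)
  have hn' : (0 : ℝ) < n := by exact_mod_cast hn
  have hsum : ∀ v, ∑ i, (⟪v, (dataset x y i).1⟫_ℝ - (dataset x y i).2) ^ 2 =
      ‖design x v - y‖ ^ 2 := by
    intro v
    rw [EuclideanSpace.norm_sq_eq]
    refine Finset.sum_congr rfl fun i _ => ?_
    simp [dataset, design_apply, real_inner_comm]
  have hmin : ∀ v, ‖design x w - y‖ ^ 2 ≤ ‖design x v - y‖ ^ 2 := by
    intro v
    have := h (dataset x y) (mem_univ v)
    simp only [mem_ofPred_eq, hsum] at this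
    exact le_of_mul_le_mul_left this (by positivity)
  have horth : ∀ v, ⟪design x w - y, design x v⟫_ℝ = 0 := by
    intro v
    set b := ⟪design x w - y, design x v⟫_ℝ
    -- Minimality along `w + s • v` is a nonnegative quadratic in `s` without constant term, so its
    -- discriminant `(2b)²` must vanish.
    have hq : ∀ s : ℝ, 0 ≤ ‖design x v‖ ^ 2 * (s * s) + (2 * b) * s + 0 := by
      intro s
      have h1 := hmin (w + s • v)
      have h2 : design x (w + s • v) - y = (design x w - y) + s • design x v := by
        rw [map_add, map_smul]; abel
      rw [h2, @norm_add_sq_real, real_inner_smul_right, norm_smul, mul_pow, Real.norm_eq_abs,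
        sq_abs] at h1
      nlinarith
    have := discrim_le_zero hq
    rw [discrim] at this
    nlinarith [sq_nonneg b]
  refine ext_inner_right ℝ fun v => ?_
  have := horth v
  rw [inner_sub_left] at this
  rw [gram_apply, zero_smul, add_zero, ContinuousLinearMap.adjoint_inner_left,
    ContinuousLinearMap.adjoint_inner_left]
  linarith

/-- The minimax risk needs one measurable competitor; its value on singular designs may be arbitrary
because the limiting loss is `∞` there. -/
theorem exists_measurable_solvesNormalEquations (hn : 0 < n) :
    ∃ what : (Fin n → EuclideanSpace ℝ (Fin d) × ℝ) → EuclideanSpace ℝ (Fin d),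
      Measurable what ∧ SolvesNormalEquations what := by
  classical
  set R : (Fin n → EuclideanSpace ℝ (Fin d)) →
      EuclideanSpace ℝ (Fin d) →L[ℝ] EuclideanSpace ℝ (Fin d) :=
    {x | IsUnit (sampleCov x)}.piecewise (fun x => Ring.inverse (gram x 0)) (fun _ => 0)
  have hR : Measurable R := by
    refine ContinuousOn.measurable_piecewise (fun x hx => ?_) continuousOn_const
      (measurableSet_isUnit_sampleCov hn)
    exact (continuousAt_inverse_gram ((isUnit_sampleCov_iff hn x).1 hx)).continuousWithinAt
  refine ⟨fun D => R (fun i => (D i).1)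
    ((design fun i => (D i).1).adjoint (WithLp.toLp 2 fun i => (D i).2)), ?_, fun x y hx => ?_⟩
  · have h1 : Measurable fun D : Fin n → EuclideanSpace ℝ (Fin d) × ℝ => R (fun i => (D i).1) :=
      hR.comp (by fun_prop)
    have h2 : Continuous fun D : Fin n → EuclideanSpace ℝ (Fin d) × ℝ =>
        (design fun i => (D i).1).adjoint (WithLp.toLp 2 fun i => (D i).2) :=
      (continuous_adjoint_design.comp (by fun_prop :
        Continuous fun (D : Fin n → EuclideanSpace ℝ (Fin d) × ℝ) i => (D i).1)).clm_apply
          (by fun_prop)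
    exact (isBoundedBilinearMap_apply (𝕜 := ℝ) (E := EuclideanSpace ℝ (Fin d))
      (F := EuclideanSpace ℝ (Fin d))).continuous.measurable.comp (h1.prodMk h2.measurable)
  · have : R x = Ring.inverse (gram x 0) := piecewise_eq_of_mem _ _ _ hx
    simp only [dataset, this]
    exact inverse_gram_spec x ((isUnit_sampleCov_iff hn x).1 hx) _

theorem SolvesNormalEquations.sub_eq_olsError (hn : 0 < n)
    {what : (Fin n → EuclideanSpace ℝ (Fin d) × ℝ) → EuclideanSpace ℝ (Fin d)}
    (h : SolvesNormalEquations what) {x : Fin n → EuclideanSpace ℝ (Fin d)}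
    (hx : IsUnit (sampleCov x)) (w : EuclideanSpace ℝ (Fin d)) (g : EuclideanSpace ℝ (Fin n)) :
    what (dataset x (design x w + Real.sqrt σsq • g)) - w = olsError σsq x g := by
  have hg := (isUnit_sampleCov_iff hn x).1 hx
  refine eq_of_gram_eq hg ?_
  rw [olsError, inverse_gram_spec x hg, map_sub, h x _ hx, gram_apply, zero_smul, add_zero,
    map_add, map_smul]
  abel

theorem SolvesNormalEquations.jointLaw_le (hn : 0 < n) (he : ConvexOn ℝ univ e)
    (he_meas : Measurable e) (he_symm : ∀ t, e (-t) = e t)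
    (hfin : ∀ Δ : EuclideanSpace ℝ (Fin d),
      Integrable (fun q : EuclideanSpace ℝ (Fin d) × ℝ => e (⟪Δ, q.1⟫_ℝ + q.2))
        (PX.prod (gaussianReal 0 σsq)))
    {what : (Fin n → EuclideanSpace ℝ (Fin d) × ℝ) → EuclideanSpace ℝ (Fin d)}
    (hwhat : Measurable what) (h : SolvesNormalEquations what) (w : EuclideanSpace ℝ (Fin d))
    (t : ℝ≥0) :
    jointLaw n PX σsq {q | limitLoss n e PX σsq q ≤ t} ≤
      Measure.pi (fun _ : Fin n => gaussLaw PX σsq w)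
        {D | ENNReal.ofReal (excessError e (gaussLaw PX σsq w) (what D)) ≤ t} := by
  have hK : MeasurableSet {Δ | tildeExcess e PX σsq Δ ≤ t} :=
    (isClosed_le (continuous_tildeExcess he hfin) continuous_const).measurableSet
  have hf : MeasurableSet {q : (Fin n → EuclideanSpace ℝ (Fin d)) × EuclideanSpace ℝ (Fin n) |
      what (dataset q.1 (design q.1 w + Real.sqrt σsq • q.2)) - w ∈
        {Δ | tildeExcess e PX σsq Δ ≤ t}} :=
    (hwhat.comp (measurable_dataset_design _ w)).sub_const w hK
  rw [pi_gaussLaw_excessError_le he he_meas he_symm hfin hwhat, jointLaw_limitLoss_le hn he hfin,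
    Measure.prod_apply hf]
  refine lintegral_mono fun x => ?_
  split_ifs with hx
  · rw [condLaw_eq_map_olsError hn σsq hx, Measure.map_apply (measurable_olsError σsq x) hK]
    refine measure_mono fun g hg => ?_
    simp only [mem_preimage, mem_ofPred_eq] at hg ⊢
    rwa [h.sub_eq_olsError hn hx]
  · exact zero_le

/-! ### From probabilities to quantiles -/

theorem quantile_mono {Ω Ω' : Type*} [MeasurableSpace Ω] [MeasurableSpace Ω'] {μ : Measure Ω}
    {ν : Measure Ω'} {L : Ω → ℝ≥0∞} {M : Ω' → ℝ≥0∞} {p : ℝ}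
    (h : ∀ t : ℝ≥0, ν {ω | M ω ≤ t} ≤ μ {ω | L ω ≤ t}) : quantile μ L p ≤ quantile ν M p :=
  le_iInf₂ fun t ht => iInf₂_le t (ht.trans (h t))

theorem le_measure_of_quantile_lt {Ω : Type*} [MeasurableSpace Ω] {μ : Measure Ω} {L : Ω → ℝ≥0∞}
    {p : ℝ} {t : ℝ≥0} (h : quantile μ L p < t) : ENNReal.ofReal p ≤ μ {ω | L ω ≤ t} := by
  obtain ⟨s, hs⟩ := iInf_lt_iff.1 h
  obtain ⟨hs1, hs2⟩ := iInf_lt_iff.1 hs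
  exact hs1.trans (measure_mono fun ω hω => le_trans hω hs2.le)

theorem SolvesNormalEquations.worstCaseRisk_le (hn : 0 < n) (he : ConvexOn ℝ univ e)
    (he_meas : Measurable e) (he_symm : ∀ t, e (-t) = e t)
    (hfin : ∀ Δ : EuclideanSpace ℝ (Fin d),
      Integrable (fun q : EuclideanSpace ℝ (Fin d) × ℝ => e (⟪Δ, q.1⟫_ℝ + q.2))
        (PX.prod (gaussianReal 0 σsq)))
    {what : (Fin n → EuclideanSpace ℝ (Fin d) × ℝ) → EuclideanSpace ℝ (Fin d)}
    (hwhat : Measurable what) (h : SolvesNormalEquations what) (δ : ℝ) :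
    worstCaseRisk e n δ (gaussClass PX σsq) what ≤
      quantile (jointLaw n PX σsq) (limitLoss n e PX σsq) (1 - δ) := by
  refine iSup₂_le fun P hP => ?_
  obtain ⟨w, rfl⟩ := hP
  exact quantile_mono fun t => h.jointLaw_le hn he he_meas he_symm hfin hwhat w t

theorem quantile_limitLoss_le_worstCaseRisk (hn : 0 < n) (hσ : 0 < σsq)
    (he : StrictConvexOn ℝ univ e) (he_meas : Measurable e) (he_symm : ∀ t, e (-t) = e t)
    (hPX : ∀ w : EuclideanSpace ℝ (Fin d), w ≠ 0 → ¬ PX.support ⊆ {x | ⟪w, x⟫_ℝ = 0})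
    (hfin : ∀ Δ : EuclideanSpace ℝ (Fin d),
      Integrable (fun q : EuclideanSpace ℝ (Fin d) × ℝ => e (⟪Δ, q.1⟫_ℝ + q.2))
        (PX.prod (gaussianReal 0 σsq)))
    {what : (Fin n → EuclideanSpace ℝ (Fin d) × ℝ) → EuclideanSpace ℝ (Fin d)}
    (hwhat : Measurable what) (δ : ℝ) :
    quantile (jointLaw n PX σsq) (limitLoss n e PX σsq) (1 - δ) ≤
      worstCaseRisk e n δ (gaussClass PX σsq) what := by
  by_contra! hlt
  -- A level strictly above the worst-case risk is reached with probability `1 - δ` for every `w`,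
  -- without asking whether the infimum in the quantile is attained.
  obtain ⟨t, ht1, ht2⟩ := ENNReal.lt_iff_exists_nnreal_btwn.1 hlt
  refine ht2.not_ge (iInf₂_le t ?_)
  refine le_jointLaw_of_forall_le hn hσ he he_meas he_symm hPX hfin hwhat fun w => ?_
  refine le_measure_of_quantile_lt (lt_of_le_of_lt ?_ ht1)
  exact le_iSup₂ (f := fun P (_ : P ∈ gaussClass PX σsq) => quantileRisk e n δ P what) _ ⟨w, rfl⟩

end LinReg

theorem theorem2p1 {d n : ℕ} (hn : 0 < n) (δ : ℝ) (hδ : δ ∈ Ioo (0 : ℝ) 1)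
    (PX : Measure (EuclideanSpace ℝ (Fin d))) [IsProbabilityMeasure PX]
    -- the support of the input distribution lies in no hyperplane
    (hPX : ∀ w : EuclideanSpace ℝ (Fin d), w ≠ 0 → ¬ PX.support ⊆ {x | ⟪w, x⟫_ℝ = 0})
    (σsq : ℝ≥0) (hσ : 0 < σsq)
    (e : ℝ → ℝ) (he_conv : StrictConvexOn ℝ univ e) (he_diff : Differentiable ℝ e)
    (he_symm : ∀ t, e (-t) = e t)
    -- finiteness of `Ẽ` everywhere
    (hfin : ∀ Δ : EuclideanSpace ℝ (Fin d),
      Integrable (fun q : EuclideanSpace ℝ (Fin d) × ℝ => e (⟪Δ, q.1⟫_ℝ + q.2))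
        (PX.prod (gaussianReal 0 σsq)))
    -- `Ẽ` is differentiable at `0` and its gradient there is `𝔼[e'(η) X]`
    (hgrad : HasGradientAt (tildeE e PX σsq)
      (∫ q : EuclideanSpace ℝ (Fin d) × ℝ, deriv e q.2 • q.1 ∂(PX.prod (gaussianReal 0 σsq))) 0) :
    minimaxQuantileRisk e n δ (gaussClass PX σsq) =
        quantile (jointLaw n PX σsq) (limitLoss n e PX σsq) (1 - δ) ∧
      ∀ what : (Fin n → EuclideanSpace ℝ (Fin d) × ℝ) → EuclideanSpace ℝ (Fin d),
        Measurable what → IsLeastSquares what →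
          IsMinimax e n δ (gaussClass PX σsq) what := by
  have he_meas : Measurable e := he_diff.continuous.measurable
  have hlow : quantile (jointLaw n PX σsq) (limitLoss n e PX σsq) (1 - δ) ≤
      minimaxQuantileRisk e n δ (gaussClass PX σsq) := le_iInf₂ fun what hwhat =>
    quantile_limitLoss_le_worstCaseRisk hn hσ he_conv he_meas he_symm hPX hfin hwhat δ
  have hup : ∀ what : (Fin n → EuclideanSpace ℝ (Fin d) × ℝ) → EuclideanSpace ℝ (Fin d),
      Measurable what → SolvesNormalEquations what →
        worstCaseRisk e n δ (gaussClass PX σsq) what ≤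
          quantile (jointLaw n PX σsq) (limitLoss n e PX σsq) (1 - δ) := fun what hwhat h =>
    h.worstCaseRisk_le hn he_conv.convexOn he_meas he_symm hfin hwhat δ
  refine ⟨le_antisymm ?_ hlow, fun what hwhat hls => ⟨hwhat, le_antisymm ?_ (iInf₂_le what hwhat)⟩⟩
  · obtain ⟨what, hwhat, h⟩ := exists_measurable_solvesNormalEquations (d := d) hn
    exact (iInf₂_le what hwhat).trans (hup what hwhat h)
  · exact (hup what hwhat (hls.solvesNormalEquations hn)).trans hlow
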